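/- Let $M$ be a smooth $m$-dimensional manifold with a smooth Riemannian metric $\langle A(x)\dot x,\dot x\rangle$, let $V_0,f:M\to\mathbb R$ be smooth, let $\mathcal L_0(x,\dot x)=\frac12\langle A(x)\dot x,\dot x\rangle-V_0(x)$, and let $\rho\ge 0$ and $\kappa$ be measurable real functions on $\mathbb R$ with $\operatorname{supp}\kappa\subset\operatorname{supp}\rho$ (up to null sets, i.e. $\kappa=0$ almost everywhere on $\{\rho=0\}$); $\kappa/\sqrt\rho$ is extended by zero to the set where $\rho=0$. Assume: (i) $\int\frac{\kappa^2}{\rho}\,d\nu<\infty$ and $K:=\int\frac{\kappa^2}{\rho\nu^2}\,d\nu<\infty$; (ii) the effective potential $V=V_0-\frac12Kf^2$ is bounded from below, either $f$ is bounded or $V\to\infty$ as $|f|\to\infty$, and all sets $\{x\in M:V(x)\le E\}$ are compact; (iii) the initial data $\xi_0,\dot\xi_0$ are measurable and $\int\rho\,(\dot\xi_0^2+\nu^2\xi_0^2)\,d\nu<\infty$. Let $\mathcal C_b$ be the space of bounded uniformly continuous functions $\mathbb R\to\mathbb C$, let $\mathcal C_0^{\pm}\subset\mathcal C_b$ be the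 subspaces of functions tending to $0$ at $\pm\infty$, let $\mathcal M$ be the space of finite complex Radon measures on $\mathbb R$, and let $\mathcal F(\psi)(\lambda)=\hat\psi(\lambda)=\int e^{-i\lambda\tau}\psi(\tau)\,d\tau$ (in the sense of tempered distributions). Put $\hat{\mathcal C}_0^\pm=\mathcal F(\mathcal C_0^\pm)$, $\hat{\mathcal C}_b=\mathcal F(\mathcal C_b)$, $\hat{\mathcal M}=\mathcal F(\mathcal M)$ (a space of continuous functions). For $\hat\mu\in\hat{\mathcal M}$ and $\hat\varphi\in\hat{\mathcal C}_b$ the product $\hat\mu\hat\varphi\in\hat{\mathcal C}_b$ is $\mathcal F(\mu*\varphi)$. For $\hat\varphi\in\hat{\mathcal C}_b$ a point $\lambda$ is not in $\operatorname{sing\,supp}^\pm\hat\varphi$ iff there is an open interval $I\ni\lambda$ such that $\hat\mu\hat\varphi\in\hat{\mathcal C}_0^\pm$ for all $\hat\mu\in\hat{\mathcal M}$ with $\operatorname{supp}\hat\mu\subset I$; $\operatorname{sing\,supp}\hat\varphi=\operatorname{sing\,supp}^+\hat\varphi\cup\operatorname{sing\,supp}^-\hat\varphi$. Assume further: (iv)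 $\kappa/\sqrt\rho$ agrees almost everywhere with a differentiable function $\hat a$ such that $\hat a,\hat a'\in\hat{\mathcal M}$ and $\hat a(0)=0$. Put $\hat w(\nu)=\frac{2\pi\hat a^2(\nu)}{i\nu}$, $\hat w(0)=0$, $w=\mathcal F^{-1}(\hat w)$, $\sigma=\{\nu:\hat a(\nu)\ne0\}$, and let $\hat w_\diamond^\pm=\mathcal F(w_\diamond^\pm)$, where $w_\diamond^\pm(\tau)=\pm\frac12(w(\tau)-w(-\tau))$ for $\pm\tau>0$ and $w_\diamond^\pm(\tau)=0$ for $\pm\tau<0$. Let $x(t)\in M$, $\xi(\nu,t)\in\mathbb R$, $t\in\mathbb R$, be a classical solution of $$\frac d{dt}\frac{\partial\mathcal L_0}{\partial\dot x}-\frac{\partial\mathcal L_0}{\partial x}=\frac{\partial f}{\partial x}\int\kappa\xi\,d\nu,\qquad \rho\,(\ddot\xi+\nu^2\xi)=\kappa f(x)$$ (the second equation for almost every $\nu$) with some initial values $x_0,\dot x_0$ of $x,\dot x$ and with initial values $\xi_0(\nu),\dot\xi_0(\nu)$ of $\xi,\dot\xi$ at $t=0$. Then the integral $\int\kappa(\nu)\xi(\nu,t)\,d\nu$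 converges for every $t$, $\hat w,w\in L_1$, the functions $\psi(t)=f(x(t))$ and $\varphi(t)=\int\kappa(\nu)\xi(\nu,t)\,d\nu$ are bounded (and belong to $\mathcal C_b$), and (1) $\hat a\hat\psi\in L_2$, $\hat w\hat\psi\in L_1$, and $\operatorname{sing\,supp}\hat\psi\cap\sigma=\emptyset$; (2) $\hat\varphi=\hat w_\diamond^+\hat\psi+\hat\vartheta^+=\hat w_\diamond^-\hat\psi+\hat\vartheta^-$ for some $\hat\vartheta^+\in\hat{\mathcal C}_0^+$ and $\hat\vartheta^-\in\hat{\mathcal C}_0^-$. -/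

import Mathlib

open MeasureTheory Filter Topology
open scoped Manifold ContDiff ENNReal SchwartzMap FourierTransform

noncomputable section

namespace OscillatorThermostat

/-! ### The oscillator and the thermostat -/

section Dynamics

variable {m : ℕ} {M : Type*} [TopologicalSpace M] [ChartedSpace (EuclideanSpace ℝ (Fin m)) M]
  [IsManifold 𝓘(ℝ, EuclideanSpace ℝ (Fin m)) ∞ M]

/-- A smooth Riemannian metric on `M`: the positive definite matrix function `A` of the kinetic
energy, written without coordinates. -/
abbrev RiemannMetric (m : ℕ) (M : Type*) [TopologicalSpace M] [ChartedSpace (EuclideanSpace ℝ (Fin m)) M]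
    [IsManifold 𝓘(ℝ, EuclideanSpace ℝ (Fin m)) ∞ M] :=
  Bundle.ContMDiffRiemannianMetric 𝓘(ℝ, EuclideanSpace ℝ (Fin m)) ∞ (EuclideanSpace ℝ (Fin m))
    (fun x : M => TangentSpace 𝓘(ℝ, EuclideanSpace ℝ (Fin m)) x)

/-- The quadratic form `v ↦ ⟨A(q) v, v⟩` in the chart `c`. -/
def kineticForm (A : RiemannMetric m M) (c : OpenPartialHomeomorph M (EuclideanSpace ℝ (Fin m)))
    (q v : EuclideanSpace ℝ (Fin m)) : ℝ :=
  A.inner (c.symm q)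
    (mfderiv 𝓘(ℝ, EuclideanSpace ℝ (Fin m)) 𝓘(ℝ, EuclideanSpace ℝ (Fin m)) c.symm q v)
    (mfderiv 𝓘(ℝ, EuclideanSpace ℝ (Fin m)) 𝓘(ℝ, EuclideanSpace ℝ (Fin m)) c.symm q v)

/-- The natural Lagrangian `⟨A(q) v, v⟩ / 2 - V₀(q)` in the chart `c`. -/
def lagrangian (A : RiemannMetric m M) (V₀ : M → ℝ)
    (c : OpenPartialHomeomorph M (EuclideanSpace ℝ (Fin m)))
    (q v : EuclideanSpace ℝ (Fin m)) : ℝ :=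
  kineticForm A c q v / 2 - V₀ (c.symm q)

/-- `(x, ξ)` is a (global, classical) solution of the coupled equations of motion
`d/dt (∂L/∂ẋ) - ∂L/∂x = (∂f/∂x) ∫ κ ξ dν`, `ρ (ξ̈ + ν² ξ) = κ f(x)`, with initial values `z₀` of
`(x, ẋ)`, `ξ₀` of `ξ` and `η₀` of `ξ̇`. The first argument of `ξ` is the frequency `ν`, the second
one is the time. Nothing is required of `ξ ν` where `ρ` vanishes: there are no oscillators there. -/
structure IsSolution (A : RiemannMetric m M) (V₀ f : M → ℝ) (ρ κ : ℝ → ℝ)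
    (z₀ : TangentBundle 𝓘(ℝ, EuclideanSpace ℝ (Fin m)) M) (ξ₀ η₀ : ℝ → ℝ)
    (x : ℝ → M) (ξ : ℝ → ℝ → ℝ) : Prop where
  contMDiff : ContMDiff 𝓘(ℝ, ℝ) 𝓘(ℝ, EuclideanSpace ℝ (Fin m)) 2 x
  eulerLagrange : ∀ c ∈ atlas (EuclideanSpace ℝ (Fin m)) M, ∀ t : ℝ, x t ∈ c.source →
    HasDerivAt
      (fun s : ℝ => fderiv ℝ (fun v => lagrangian A V₀ c (c (x s)) v) (deriv (fun r => c (x r)) s))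
      (fderiv ℝ (fun q => lagrangian A V₀ c q (deriv (fun r => c (x r)) t)) (c (x t))
        + (∫ ν, κ ν * ξ ν t) • fderiv ℝ (fun q => f (c.symm q)) (c (x t))) t
  oscillators : ∀ᵐ ν : ℝ, ρ ν ≠ 0 → ContDiff ℝ 2 (ξ ν) ∧
    ∀ t : ℝ, ρ ν * (deriv (deriv (ξ ν)) t + ν ^ 2 * ξ ν t) = κ ν * f (x t)
  initial_x : (⟨x 0, mfderiv 𝓘(ℝ, ℝ) 𝓘(ℝ, EuclideanSpace ℝ (Fin m)) x 0 (1 : ℝ)⟩ :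
    TangentBundle 𝓘(ℝ, EuclideanSpace ℝ (Fin m)) M) = z₀
  initial_ξ : ∀ᵐ ν : ℝ, ρ ν ≠ 0 → ξ ν 0 = ξ₀ ν ∧ deriv (ξ ν) 0 = η₀ ν

/-- The constant `K = ∫ κ² / (ρ ν²) dν`. -/
def couplingConst (ρ κ : ℝ → ℝ) : ℝ := ∫ ν, κ ν ^ 2 / (ρ ν * ν ^ 2)

/-- The effective potential `V = V₀ - K f² / 2`. -/
def effPotential (V₀ f : M → ℝ) (ρ κ : ℝ → ℝ) (x : M) : ℝ :=
  V₀ x - couplingConst ρ κ * f x ^ 2 / 2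

end Dynamics

/-! ### Fourier transform of functions and of tempered distributions -/

/-- `∫ exp(-i ν τ) u(τ) dτ` -/
def fourierFun (u : ℝ → ℂ) (ν : ℝ) : ℂ := ∫ τ : ℝ, Complex.exp (-Complex.I * ν * τ) * u τ

/-- `(1 / 2π) ∫ exp(i ν τ) u(ν) dν` -/
def fourierInvFun (u : ℝ → ℂ) (τ : ℝ) : ℂ :=
  1 / (2 * Real.pi) * ∫ ν : ℝ, Complex.exp (Complex.I * ν * τ) * u ν

/-- The dilation `τ ↦ τ / 2π`, relating Mathlib's normalization `exp(-2π i ν τ)` to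
`exp(-i ν τ)`. -/
def scale : ℝ ≃L[ℝ] ℝ :=
  ContinuousLinearEquiv.unitsEquivAut ℝ (Units.mk0 (2 * Real.pi)⁻¹ (by positivity))

/-- The Fourier transform `h ↦ ∫ exp(-i ν τ) h(τ) dτ` on Schwartz functions. -/
def fourierSchwartz : 𝓢(ℝ, ℂ) →L[ℂ] 𝓢(ℝ, ℂ) :=
  (SchwartzMap.compCLMOfContinuousLinearEquiv ℂ scale).comp
    (FourierTransform.fourierCLM ℂ 𝓢(ℝ, ℂ))

theorem fourierSchwartz_apply (h : 𝓢(ℝ, ℂ)) (ν : ℝ) :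
    fourierSchwartz h ν = fourierFun h ν := by
  change (𝓕 h : 𝓢(ℝ, ℂ)) (scale ν) = _
  rw [SchwartzMap.fourier_coe, Real.fourier_real_eq_integral_exp_smul]
  simp only [fourierFun, scale, ContinuousLinearEquiv.unitsEquivAut_apply, Units.val_mk0,
    smul_eq_mul]
  refine integral_congr_ae (Eventually.of_forall fun τ => ?_)
  have hpi : (Real.pi : ℂ) ≠ 0 := by exact_mod_cast Real.pi_ne_zero
  dsimp only
  congr 2
  push_cast
  field_simp

/-- The Fourier transform of a tempered distribution: `⟨F T, h⟩ = ⟨T, F h⟩`. -/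
def fourierDistr (T : 𝓢'(ℝ, ℂ)) : 𝓢'(ℝ, ℂ) :=
  PointwiseConvergenceCLM.precomp ℂ fourierSchwartz T

open Classical in
/-- The tempered distribution `h ↦ ∫ h φ` of a bounded measurable function `φ` (zero for all other
`φ`). -/
def funDistr (φ : ℝ → ℂ) : 𝓢'(ℝ, ℂ) :=
  if h : MemLp φ ∞ volume then Lp.toTemperedDistribution h.toLp else 0

/-- The distribution `φ̂ = F(φ)`, for a bounded measurable function `φ`. -/
def hat (φ : ℝ → ℂ) : 𝓢'(ℝ, ℂ) := fourierDistr (funDistr φ)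

/-- The distribution `T` is given by a function from `L_p`. -/
def IsLp (p : ℝ≥0∞) [Fact (1 ≤ p)] (T : 𝓢'(ℝ, ℂ)) : Prop :=
  ∃ g : Lp ℂ p (volume : Measure ℝ), T = Lp.toTemperedDistribution g

/-! ### The spaces `C_b`, `C_0^±`, `M` and their Fourier images -/

/-- Bounded uniformly continuous functions `ℝ → ℂ`. -/
def Cb : Set (ℝ → ℂ) := {φ | UniformContinuous φ ∧ ∃ C : ℝ, ∀ t, ‖φ t‖ ≤ C}

/-- Functions from `C_b` that tend to zero along `l`. The space `C_0^+` is `C0 atTop` and the space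
`C_0^-` is `C0 atBot`. -/
def C0 (l : Filter ℝ) : Set (ℝ → ℂ) := {φ | φ ∈ Cb ∧ Tendsto φ l (𝓝 0)}

/-- The Fourier image of `C_0^±`. -/
def C0Hat (l : Filter ℝ) : Set 𝓢'(ℝ, ℂ) := hat '' C0 l

/-- The integral `∫ u dμ` over a complex measure, through the Jordan decompositions of the real and
imaginary parts of `μ`. -/
def cintegral (μ : ComplexMeasure ℝ) (u : ℝ → ℂ) : ℂ :=
  ((∫ τ, u τ ∂(ComplexMeasure.re μ).toJordanDecomposition.posPart)
      - ∫ τ, u τ ∂(ComplexMeasure.re μ).toJordanDecomposition.negPart)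
    + Complex.I * ((∫ τ, u τ ∂(ComplexMeasure.im μ).toJordanDecomposition.posPart)
      - ∫ τ, u τ ∂(ComplexMeasure.im μ).toJordanDecomposition.negPart)

/-- The Fourier transform `μ̂(ν) = ∫ exp(-i ν τ) dμ(τ)` of a complex measure. -/
def measureHat (μ : ComplexMeasure ℝ) (ν : ℝ) : ℂ :=
  cintegral μ (fun τ => Complex.exp (-Complex.I * ν * τ))

/-- The space of Fourier transforms of finite complex measures. -/
def MHat : Set (ℝ → ℂ) := Set.range measureHat

/-- The convolution `(μ * φ)(t) = ∫ φ(t - τ) dμ(τ)`. -/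
def conv (μ : ComplexMeasure ℝ) (φ : ℝ → ℂ) (t : ℝ) : ℂ :=
  cintegral μ (fun τ => φ (t - τ))

/-- `S` is the product `k T` of a function `k = μ̂` from the Fourier image of the finite measures
and a distribution `T = φ̂` from the Fourier image of `C_b`, which is, by definition, the Fourier
transform of `μ * φ`. (Here `μ` and `φ` are determined by `k` and `T`.) -/
def IsProd (k : ℝ → ℂ) (T S : 𝓢'(ℝ, ℂ)) : Prop :=
  ∃ μ : ComplexMeasure ℝ, ∃ φ ∈ Cb, k = measureHat μ ∧ T = hat φ ∧ S = hat (conv μ φ)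

/-- The singular support of `T` along `l`: a point `s` is not in it if there is an open interval
`I ∋ s` such that `k T` lies in the Fourier image of `C0 l` for every Fourier transform `k` of a
finite measure that is supported in `I`. -/
def singSuppAlong (l : Filter ℝ) (T : 𝓢'(ℝ, ℂ)) : Set ℝ :=
  {s | ¬ ∃ b c : ℝ, s ∈ Set.Ioo b c ∧ ∀ k ∈ MHat, tsupport k ⊆ Set.Ioo b c →
    ∃ S ∈ C0Hat l, IsProd k T S}

/-- The singular support, the union of the ones along `+∞` and along `-∞`. -/
def singSupp (T : 𝓢'(ℝ, ℂ)) : Set ℝ := singSuppAlong atTop T ∪ singSuppAlong atBot T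

/-! ### The kernels built from `â` -/

/-- `ŵ(ν) = 2π â(ν)² / (i ν)`. The convention `z / 0 = 0` gives `ŵ(0) = 0`. -/
def wHat (a : ℝ → ℝ) (ν : ℝ) : ℂ := 2 * Real.pi * (a ν : ℂ) ^ 2 / (Complex.I * ν)

/-- `w = F⁻¹(ŵ)` -/
def wKer (a : ℝ → ℝ) : ℝ → ℂ := fourierInvFun (wHat a)

/-- `(w(τ) - w(-τ)) / 2` for `τ > 0`, and zero otherwise. -/
def wDiamondPlus (a : ℝ → ℝ) (τ : ℝ) : ℂ :=
  if 0 < τ then (wKer a τ - wKer a (-τ)) / 2 else 0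

/-- `-(w(τ) - w(-τ)) / 2` for `τ < 0`, and zero otherwise. -/
def wDiamondMinus (a : ℝ → ℝ) (τ : ℝ) : ℂ :=
  if τ < 0 then -((wKer a τ - wKer a (-τ)) / 2) else 0

end OscillatorThermostat

end

/-!
The proof rests on conservation of energy. Let `z_ν = √ρ (ξ̇ + i ν ξ)` be the complex amplitude of the
oscillator with frequency `ν`. It solves `ż = i ν z + a ψ`, hence is given in closed form by its
initial value and by `ψ = f ∘ x` (`oscAmp`), and the force on `x` is `φ = ∫ (a / ν) Im z dν`. Relative
to the moving equilibrium `i (a / ν) ψ` the oscillators have the energy `J = ½ ∫ |z - i (a / ν) ψ|² dν`,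
and the Euler-Lagrange equations give the conservation of
`½ ⟨A ẋ, ẋ⟩ + V(x) + J`, with the effective potential `V` (`hasDerivAt_oscEnergy`,
`hasDerivAt_mechanicalEnergy`). All three terms are bounded below, so all are bounded
(`exists_bounds`): `x` stays in a compact sublevel set of `V`, therefore `ψ` is bounded, and `ψ̇` is
bounded because the speed is.

The bound on `J` bounds `‖z(t)‖` in `L²` uniformly in `t ∈ ℝ`. Since
`a F(ψ 1_{(-n, n]}) = e^{-iνn} z(n) - e^{iνn} z(-n)`, these functions are bounded in `L²`
(`exists_eLpNorm_window_le`), and a weak limit `g ∈ L²` represents the distribution `a ψ̂`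
(`exists_memLp_two_hat_conv`). Multiplication by `2π a / (i ν) ∈ L²` shows `ŵ ψ̂ ∈ L¹`. The function
with the Fourier transform `a ψ̂` is both square integrable and uniformly continuous, so it vanishes
at `±∞` (`tendsto_zero_of_memLp_two`), and locally one may divide by `a` within the Fourier images of
`L¹` (`notMem_singSuppAlong`): this is the statement about the singular support.

For the second assertion, the closed form of `z` splits `φ` into a term that depends on the initial
data, which vanishes at `±∞` by the Riemann-Lebesgue lemma, and the retarded convolution
`∫₀ᵗ k(τ) ψ(t - τ) dτ` with `k(τ) = (w(τ) - w(-τ)) / 2` (`integral_mul_im_oscAmp`). As `w` is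
integrable (`inWiener_wHat`), the latter differs from the full convolution of `ψ` with `k 1_{(0, ∞)}`
by a function that vanishes at `+∞`, and similarly at `-∞`.
-/

noncomputable section

namespace OscillatorThermostat

/-! ### The Fourier transform of integrable and of square integrable functions -/

theorem norm_exp_neg_I_mul (ν τ : ℝ) : ‖Complex.exp (-Complex.I * ν * τ)‖ = 1 := by
  rw [Complex.norm_exp]; simp

theorem norm_exp_I_mul (ν τ : ℝ) : ‖Complex.exp (Complex.I * ν * τ)‖ = 1 := by
  rw [Complex.norm_exp]; simp

theorem fourierFun_eq_fourier (u : ℝ → ℂ) (ν : ℝ) :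
    fourierFun u ν = 𝓕 u (ν / (2 * Real.pi)) := by
  rw [Real.fourier_real_eq_integral_exp_smul]
  simp only [fourierFun, smul_eq_mul]
  refine integral_congr_ae (Eventually.of_forall fun τ => ?_)
  have hpi : (Real.pi : ℂ) ≠ 0 := by exact_mod_cast Real.pi_ne_zero
  dsimp only
  congr 2
  push_cast
  field_simp

theorem norm_fourierFun_le (u : ℝ → ℂ) (ν : ℝ) : ‖fourierFun u ν‖ ≤ ∫ τ, ‖u τ‖ := by
  refine (norm_integral_le_integral_norm _).trans (le_of_eq ?_)
  simp only [norm_mul, norm_exp_neg_I_mul, one_mul]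

theorem _root_.MeasureTheory.Integrable.exp_neg_I_mul {u : ℝ → ℂ} (hu : Integrable u) (ν : ℝ) :
    Integrable fun τ : ℝ => Complex.exp (-Complex.I * ν * τ) * u τ :=
  hu.bdd_mul (c := 1) (by fun_prop)
    (Eventually.of_forall fun τ => (norm_exp_neg_I_mul ν τ).le)

theorem continuous_fourierFun {u : ℝ → ℂ} (hu : Integrable u) : Continuous (fourierFun u) := by
  refine continuous_of_dominated (bound := fun τ => ‖u τ‖)
    (fun ν => (hu.exp_neg_I_mul ν).aestronglyMeasurable) (fun ν => Eventually.of_forall fun τ => ?_)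
    hu.norm (Eventually.of_forall fun τ => by fun_prop)
  rw [norm_mul, norm_exp_neg_I_mul, one_mul]

theorem tendsto_fourierFun {u : ℝ → ℂ} : Tendsto (fourierFun u) (cocompact ℝ) (𝓝 0) := by
  have h := (Real.zero_at_infty_fourier u).comp
    ((Homeomorph.mulRight₀ ((2 * Real.pi)⁻¹) (by positivity)).isClosedEmbedding.tendsto_cocompact)
  refine h.congr fun ν => ?_
  rw [fourierFun_eq_fourier]
  rfl

/-- The multiplication formula for integrable functions. -/
theorem integral_fourierFun_mul {u v : ℝ → ℂ} (hu : Integrable u) (hv : Integrable v) :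
    ∫ ν, fourierFun u ν * v ν = ∫ τ, u τ * fourierFun v τ := by
  have h : ∀ ν, fourierFun u ν * v ν
      = ∫ τ : ℝ, Complex.exp (-Complex.I * ν * τ) * (v ν * u τ) := by
    intro ν
    rw [fourierFun, ← integral_mul_const]
    exact integral_congr_ae (Eventually.of_forall fun τ => by ring)
  have h' : ∀ τ, u τ * fourierFun v τ
      = ∫ ν : ℝ, Complex.exp (-Complex.I * ν * τ) * (v ν * u τ) := by
    intro τ
    rw [fourierFun, ← integral_const_mul]
    refine integral_congr_ae (Eventually.of_forall fun ν => ?_)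
    dsimp only
    rw [show -Complex.I * (τ : ℂ) * ν = -Complex.I * ν * τ by ring]
    ring
  simp_rw [h, h']
  refine integral_integral_swap ?_
  refine (hv.mul_prod hu).bdd_mul (c := 1) ?_ (Eventually.of_forall fun p => ?_)
  · exact Continuous.aestronglyMeasurable (by fun_prop)
  · exact (norm_exp_neg_I_mul p.1 p.2).le

theorem fourierInvFun_eq_fourierFun (u : ℝ → ℂ) (τ : ℝ) :
    fourierInvFun u τ = 1 / (2 * Real.pi) * fourierFun u (-τ) := by
  unfold fourierInvFun fourierFun
  congr 1
  refine integral_congr_ae (Eventually.of_forall fun ν => ?_)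
  dsimp only
  congr 2
  push_cast
  ring

theorem integrable_fourierInvFun {u : ℝ → ℂ} (h : Integrable (fourierFun u)) :
    Integrable (fourierInvFun u) := by
  have : fourierInvFun u = fun τ => 1 / (2 * Real.pi) * fourierFun u (-τ) :=
    funext (fourierInvFun_eq_fourierFun u)
  rw [this]
  exact h.comp_neg.const_mul _

theorem integrable_fourierFun_iff {u : ℝ → ℂ} : Integrable (fourierFun u) ↔ Integrable (𝓕 u) := by
  have : fourierFun u = fun ν => 𝓕 u (ν / (2 * Real.pi)) := funext (fourierFun_eq_fourier u)
  rw [this]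
  exact integrable_comp_div_iff _ (by positivity)

/-- Fourier inversion in the normalization of `fourierFun`. -/
theorem fourierFun_fourierInvFun {u : ℝ → ℂ} (hc : Continuous u) (hu : Integrable u)
    (h : Integrable (fourierFun u)) : fourierFun (fourierInvFun u) = u := by
  have hu' := integrable_fourierFun_iff.1 h
  ext ν
  have h1 : fourierFun (fourierInvFun u) ν
      = ∫ τ : ℝ, (1 / (2 * Real.pi) : ℂ) * (Complex.exp (Complex.I * ν * τ) * fourierFun u τ) := by
    rw [fourierFun, ← integral_neg_eq_self]
    refine integral_congr_ae (Eventually.of_forall fun τ => ?_)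
    simp only [fourierInvFun_eq_fourierFun, neg_neg]
    rw [show -Complex.I * (ν : ℂ) * ((-τ : ℝ) : ℂ) = Complex.I * ν * τ by push_cast; ring]
    ring
  have h2 : 𝓕⁻ (𝓕 u) ν = u ν := congrFun (hc.fourierInv_fourier_eq hu hu') ν
  rw [h1, ← h2, Real.fourierInv_eq', integral_const_mul]
  have h4 := Measure.integral_comp_mul_right
    (fun τ : ℝ => Complex.exp (Complex.I * ν * τ) * fourierFun u τ) (2 * Real.pi)
  rw [abs_of_pos (by positivity)] at h4
  have h5 : (∫ τ : ℝ, Complex.exp (Complex.I * ν * τ) * fourierFun u τ)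
      = (2 * Real.pi) • ∫ τ : ℝ, Complex.exp (Complex.I * ν * ((τ * (2 * Real.pi) : ℝ) : ℂ))
        * fourierFun u (τ * (2 * Real.pi)) := by
    rw [h4, smul_smul, mul_inv_cancel₀ (by positivity), one_smul]
  rw [h5, Complex.real_smul]
  push_cast
  rw [← mul_assoc, one_div, inv_mul_cancel₀ (by simp), one_mul]
  refine integral_congr_ae (Eventually.of_forall fun τ => ?_)
  simp only [smul_eq_mul, fourierFun_eq_fourier]
  rw [mul_div_assoc, div_self (by positivity), mul_one]
  congr 2
  simp
  ring

/-- Two locally integrable functions that define the same tempered distribution agree almost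
everywhere. -/
theorem ae_eq_of_forall_integral_schwartz_mul {u v : ℝ → ℂ} (hu : LocallyIntegrable u)
    (hv : LocallyIntegrable v) (hui : ∀ h : 𝓢(ℝ, ℂ), Integrable fun t => h t * u t)
    (hvi : ∀ h : 𝓢(ℝ, ℂ), Integrable fun t => h t * v t)
    (huv : ∀ h : 𝓢(ℝ, ℂ), ∫ t, h t * u t = ∫ t, h t * v t) : u =ᵐ[volume] v := by
  have : ∀ᵐ t, (u - v) t = 0 := by
    refine ae_eq_zero_of_integral_contDiff_smul_eq_zero (hu.sub hv) fun g g_smooth g_cpt => ?_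
    have hg₁ : HasCompactSupport (Complex.ofRealCLM ∘ g) := g_cpt.comp_left rfl
    have hg₂ : ContDiff ℝ ∞ (Complex.ofRealCLM ∘ g) := by fun_prop
    have h := huv (hg₁.toSchwartzMap hg₂)
    rw [← sub_eq_zero, ← integral_sub (hui _) (hvi _)] at h
    rw [← h]
    refine integral_congr_ae (Eventually.of_forall fun t => ?_)
    simp [mul_sub]
  filter_upwards [this] with t ht
  simpa [sub_eq_zero] using ht

theorem _root_.MeasureTheory.MemLp.integrable_schwartz_mul {p : ℝ≥0∞} (hp : 1 ≤ p) {u : ℝ → ℂ}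
    (hu : MemLp u p) (h : 𝓢(ℝ, ℂ)) : Integrable fun t => h t * u t := by
  have := ENNReal.HolderConjugate.inv_one_sub_inv' hp
  exact (h.memLp (1 - p⁻¹)⁻¹ volume).integrable_mul (q := p) hu

/-- Plancherel's theorem, as the statement that the Fourier transform of a function from
`L¹ ∩ L²` lies in `L²`. -/
theorem memLp_fourierFun {u : ℝ → ℂ} (hu : Integrable u) (hu2 : MemLp u 2) :
    MemLp (fourierFun u) 2 := by
  have key : MemLp (𝓕 u) 2 := by
    set G : Lp ℂ 2 (volume : Measure ℝ) := 𝓕 hu2.toLp with hG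
    have hbdd : MemLp (𝓕 u) ∞ :=
      memLp_top_of_bound (VectorFourier.fourierIntegral_continuous Real.continuous_fourierChar
        (by exact continuous_inner) hu).aestronglyMeasurable (∫ v, ‖u v‖)
        (Eventually.of_forall fun ν =>
          VectorFourier.norm_fourierIntegral_le_integral_norm _ _ _ _ ν)
    have hGu : G =ᵐ[volume] 𝓕 u := by
      refine ae_eq_of_forall_integral_schwartz_mul ((Lp.memLp G).locallyIntegrable (by norm_num))
        (hbdd.locallyIntegrable le_top) (fun h => (Lp.memLp G).integrable_schwartz_mul (by norm_num) h)
        (fun h => hbdd.integrable_schwartz_mul le_top h) fun h => ?_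
      have h1 := DFunLike.congr_fun (Lp.fourier_toTemperedDistribution_eq hu2.toLp) h
      rw [TemperedDistribution.fourier_apply, Lp.toTemperedDistribution_apply,
        Lp.toTemperedDistribution_apply] at h1
      simp only [smul_eq_mul] at h1
      rw [← hG] at h1
      rw [← h1]
      have h2 : ∫ t, (𝓕 h : 𝓢(ℝ, ℂ)) t * (hu2.toLp u : Lp ℂ 2 (volume : Measure ℝ)) t
          = ∫ t, (𝓕 h : 𝓢(ℝ, ℂ)) t * u t :=
        integral_congr_ae (by filter_upwards [hu2.coeFn_toLp] with t ht; rw [ht])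
      rw [h2]
      have h3 := VectorFourier.integral_fourierIntegral_smul_eq_flip (μ := volume) (ν := volume)
        (L := innerₗ ℝ) (f := (h : ℝ → ℂ)) (g := u) Real.continuous_fourierChar
        (by exact continuous_inner) h.integrable hu
      simp only [smul_eq_mul] at h3
      rw [SchwartzMap.fourier_coe]
      rw [flip_innerₗ] at h3
      exact h3
    exact (memLp_congr_ae hGu).1 (Lp.memLp G)
  have : fourierFun u = fun ν => 𝓕 u (ν / (2 * Real.pi)) := funext (fourierFun_eq_fourier u)
  have hc := continuous_fourierFun hu
  rw [memLp_two_iff_integrable_sq_norm hc.aestronglyMeasurable, this]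
  have h2 := (memLp_two_iff_integrable_sq_norm key.1).1 key
  exact h2.comp_div (by positivity)

/-- The inequality by which a function `u` with `u, ν u ∈ L²` is integrable. -/
theorem le_sq_add_inv_one_add_sq {x : ℝ} (hx : 0 ≤ x) (ν : ℝ) :
    x ≤ x ^ 2 + ν ^ 2 * x ^ 2 + (1 + ν ^ 2)⁻¹ := by
  have hp : 0 < 1 + ν ^ 2 := by positivity
  have : x ^ 2 + ν ^ 2 * x ^ 2 + (1 + ν ^ 2)⁻¹ - x
      = (((1 + ν ^ 2) * x - 1) ^ 2 + (1 + ν ^ 2) * x) / (1 + ν ^ 2) := by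
    field_simp; ring
  have : 0 ≤ (((1 + ν ^ 2) * x - 1) ^ 2 + (1 + ν ^ 2) * x) / (1 + ν ^ 2) := by positivity
  linarith

/-- A function from the Sobolev class `W^{1,2} ∩ W^{1,1}` has an integrable Fourier transform. -/
theorem integrable_fourierFun_of_deriv {u : ℝ → ℂ} (hd : Differentiable ℝ u) (hu : Integrable u)
    (hu2 : MemLp u 2) (hu' : Integrable (deriv u)) (hu'2 : MemLp (deriv u) 2) :
    Integrable (fourierFun u) := by
  have h1 := (memLp_two_iff_integrable_sq_norm (continuous_fourierFun hu).aestronglyMeasurable).1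
    (memLp_fourierFun hu hu2)
  have h2 := (memLp_two_iff_integrable_sq_norm (continuous_fourierFun hu').aestronglyMeasurable).1
    (memLp_fourierFun hu' hu'2)
  refine ((h1.add h2).add integrable_inv_one_add_sq).mono'
    (continuous_fourierFun hu).aestronglyMeasurable (Eventually.of_forall fun ν => ?_)
  have h3 : fourierFun (deriv u) ν = Complex.I * ν * fourierFun u ν := by
    rw [fourierFun_eq_fourier, fourierFun_eq_fourier, Real.fourier_deriv hu hd hu']
    have hpi : (Real.pi : ℂ) ≠ 0 := by exact_mod_cast Real.pi_ne_zero
    simp only [smul_eq_mul]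
    push_cast
    field_simp
  simp only [Pi.add_apply, h3, norm_mul, Complex.norm_I, one_mul, Complex.norm_real,
    Real.norm_eq_abs, mul_pow, sq_abs]
  set x := ‖fourierFun u ν‖
  have hx : 0 ≤ x := norm_nonneg _
  exact le_sq_add_inv_one_add_sq hx ν

/-! ### Distributions given by bounded functions -/

theorem hat_apply {φ : ℝ → ℂ} (hφ : MemLp φ ∞) (h : 𝓢(ℝ, ℂ)) :
    hat φ h = ∫ t, φ t * fourierFun h t := by
  have h1 : hat φ h = funDistr φ (fourierSchwartz h) := rfl
  rw [h1, funDistr, dif_pos hφ, Lp.toTemperedDistribution_apply]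
  refine integral_congr_ae ?_
  filter_upwards [hφ.coeFn_toLp] with t ht
  rw [ht, smul_eq_mul, fourierSchwartz_apply, mul_comm]

theorem integrable_fourierFun_schwartz (h : 𝓢(ℝ, ℂ)) : Integrable (fourierFun h) := by
  have : fourierFun h = fourierSchwartz h := funext fun ν => (fourierSchwartz_apply h ν).symm
  rw [this]
  exact (fourierSchwartz h).integrable

theorem memLp_top_of_mem_Cb {φ : ℝ → ℂ} (hφ : φ ∈ Cb) : MemLp φ ∞ := by
  obtain ⟨hc, C, hC⟩ := hφ
  exact memLp_top_of_bound hc.continuous.aestronglyMeasurable C (Eventually.of_forall hC)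

/-- A bounded function whose Fourier transform is given by a square integrable function is itself
square integrable. -/
theorem memLp_two_of_hat {χ : ℝ → ℂ} (hχ : MemLp χ ∞) {g : ℝ → ℂ} (hg : MemLp g 2)
    (h : ∀ k : 𝓢(ℝ, ℂ), hat χ k = ∫ ν, g ν * k ν) : MemLp χ 2 := by
  have hgs : MemLp (fun s => g (2 * Real.pi * s)) 2 := by
    have hm : AEStronglyMeasurable (fun s => g (2 * Real.pi * s)) volume :=
      hg.1.comp_quasiMeasurePreserving (Measure.quasiMeasurePreserving_smul volume
        (by positivity : 2 * Real.pi ≠ 0))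
    rw [memLp_two_iff_integrable_sq_norm hm]
    exact ((memLp_two_iff_integrable_sq_norm hg.1).1 hg).comp_mul_left' (by positivity)
  -- `χ` is the inverse `L²`-Fourier transform of `g`, up to the factor `2π` in the frequency
  set G : Lp ℂ 2 (volume : Measure ℝ) := 𝓕⁻ hgs.toLp with hG
  have hGχ : χ =ᵐ[volume] G := by
    refine ae_eq_of_forall_integral_schwartz_mul (hχ.locallyIntegrable le_top)
      ((Lp.memLp G).locallyIntegrable (by norm_num))
      (fun k => hχ.integrable_schwartz_mul le_top k)
      (fun k => (Lp.memLp G).integrable_schwartz_mul (by norm_num) k) fun k => ?_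
    have h1 := DFunLike.congr_fun (Lp.fourierInv_toTemperedDistribution_eq hgs.toLp) k
    rw [TemperedDistribution.fourierInv_apply, Lp.toTemperedDistribution_apply,
      Lp.toTemperedDistribution_apply] at h1
    simp only [smul_eq_mul] at h1
    rw [← hG] at h1
    rw [← h1]
    set l : 𝓢(ℝ, ℂ) := 𝓕⁻ k with hl
    have hk : k = 𝓕 l := by simp [hl]
    have h2 := h (SchwartzMap.compCLMOfContinuousLinearEquiv ℂ scale l)
    rw [hat_apply hχ] at h2
    have hsc : ∀ s, scale s = s * (2 * Real.pi)⁻¹ := fun s => by simp [scale]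
    have h3 : ∀ t, fourierFun (SchwartzMap.compCLMOfContinuousLinearEquiv ℂ scale l) t
        = 2 * Real.pi * k t := by
      intro t
      have h4 := Measure.integral_comp_mul_right
        (fun s : ℝ => Complex.exp (-2 * Real.pi * Complex.I * t * s) * l s) (2 * Real.pi)⁻¹
      rw [abs_of_pos (by positivity), inv_inv] at h4
      rw [hk, SchwartzMap.fourier_coe, Real.fourier_real_eq_integral_exp_smul]
      have h5 : (2 * Real.pi : ℂ) * ∫ v : ℝ, Complex.exp (((-2 * Real.pi * v * t : ℝ) : ℂ)
          * Complex.I) • l v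
          = (2 * Real.pi) • ∫ s : ℝ, Complex.exp (-2 * Real.pi * Complex.I * t * s) * l s := by
        rw [Complex.real_smul]
        push_cast
        congr 1
        refine integral_congr_ae (Eventually.of_forall fun s => ?_)
        simp only [smul_eq_mul]
        congr 2
        ring
      rw [h5, ← h4]
      unfold fourierFun
      refine integral_congr_ae (Eventually.of_forall fun s => ?_)
      simp only [SchwartzMap.compCLMOfContinuousLinearEquiv_apply, Function.comp, hsc]
      congr 2
      push_cast
      field_simp
    simp_rw [h3] at h2
    have h6 := Measure.integral_comp_mul_right
        (fun s : ℝ => g (2 * Real.pi * s) * l s) (2 * Real.pi)⁻¹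
    rw [abs_of_pos (by positivity), inv_inv] at h6
    have h7 : ∫ ν, g ν * SchwartzMap.compCLMOfContinuousLinearEquiv ℂ scale l ν
        = (2 * Real.pi) • ∫ s : ℝ, g (2 * Real.pi * s) * l s := by
      rw [← h6]
      refine integral_congr_ae (Eventually.of_forall fun s => ?_)
      simp only [SchwartzMap.compCLMOfContinuousLinearEquiv_apply, Function.comp, hsc]
      congr 2
      field_simp
    rw [h7, Complex.real_smul] at h2
    have h8 : ∫ t, χ t * (2 * Real.pi * k t) = ((2 * Real.pi : ℝ) : ℂ) * ∫ t, k t * χ t := by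
      rw [← integral_const_mul]
      refine integral_congr_ae (Eventually.of_forall fun s => ?_)
      simp only
      push_cast
      ring
    rw [h8] at h2
    rw [mul_left_cancel₀ (by simp) h2]
    refine integral_congr_ae ?_
    filter_upwards [hgs.coeFn_toLp] with s hs
    rw [hs, mul_comm]
  exact (memLp_congr_ae hGχ).2 (Lp.memLp G)

/-! ### Integration against complex measures -/

/-- The complex measure `μ` has density `D` with respect to the positive measure `m`, in the sense
that `∫ u dμ = ∫ D u dm` for all bounded continuous `u`. Every complex measure has such a
representation, which reduces integrals against `μ` to Bochner integrals. -/
structure HasDensity (μ : ComplexMeasure ℝ) (m : Measure ℝ) (D : ℝ → ℂ) : Prop where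
  integrable : Integrable D m
  cintegral_eq : ∀ u : ℝ → ℂ, Continuous u → (∃ C : ℝ, ∀ t, ‖u t‖ ≤ C) →
    cintegral μ u = ∫ τ, D τ * u τ ∂m

theorem exists_hasDensity (μ : ComplexMeasure ℝ) :
    ∃ (m : Measure ℝ) (D : ℝ → ℂ), IsFiniteMeasure m ∧ HasDensity μ m D := by
  set p1 := (ComplexMeasure.re μ).toJordanDecomposition.posPart with hp1
  set p2 := (ComplexMeasure.re μ).toJordanDecomposition.negPart with hp2
  set p3 := (ComplexMeasure.im μ).toJordanDecomposition.posPart with hp3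
  set p4 := (ComplexMeasure.im μ).toJordanDecomposition.negPart with hp4
  -- all four parts have densities with respect to their sum
  set m := p1 + p2 + p3 + p4 with hm
  have : IsFiniteMeasure m := by rw [hm]; infer_instance
  have a1 : p1 ≪ m := Measure.absolutelyContinuous_of_le (by
    rw [hm, add_assoc, add_assoc]; exact Measure.le_add_right le_rfl)
  have a2 : p2 ≪ m := Measure.absolutelyContinuous_of_le (by
    rw [hm, add_assoc]
    exact Measure.le_add_right (Measure.le_add_left le_rfl))
  have a3 : p3 ≪ m := Measure.absolutelyContinuous_of_le
    (Measure.le_add_right (Measure.le_add_left le_rfl))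
  have a4 : p4 ≪ m := Measure.absolutelyContinuous_of_le (Measure.le_add_left le_rfl)
  have hi : ∀ p : Measure ℝ, IsFiniteMeasure p →
      Integrable (fun τ => (((p.rnDeriv m τ).toReal : ℝ) : ℂ)) m := fun p _ =>
    (Measure.integrable_toReal_rnDeriv (μ := p) (ν := m)).ofReal
  refine ⟨m, fun τ => ((p1.rnDeriv m τ).toReal - (p2.rnDeriv m τ).toReal)
    + Complex.I * ((p3.rnDeriv m τ).toReal - (p4.rnDeriv m τ).toReal), inferInstance, ?_, ?_⟩
  · exact ((hi p1 inferInstance).sub (hi p2 inferInstance)).add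
      (((hi p3 inferInstance).sub (hi p4 inferInstance)).const_mul _)
  · rintro u hu ⟨C, hC⟩
    have hint : ∀ p : Measure ℝ, IsFiniteMeasure p →
        Integrable (fun τ => (((p.rnDeriv m τ).toReal : ℝ) : ℂ) * u τ) m := fun p hp =>
      (hi p hp).mul_bdd (c := C) hu.aestronglyMeasurable (Eventually.of_forall hC)
    have hval : ∀ p : Measure ℝ, IsFiniteMeasure p → p ≪ m →
        ∫ τ, u τ ∂p = ∫ τ, (((p.rnDeriv m τ).toReal : ℝ) : ℂ) * u τ ∂m := fun p hp hpm => by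
      have := Measure.haveLebesgueDecomposition_of_sigmaFinite p m
      rw [← integral_rnDeriv_smul hpm]
      simp only [Complex.real_smul]
    unfold cintegral
    rw [← hp1, ← hp2, ← hp3, ← hp4, hval p1 inferInstance a1, hval p2 inferInstance a2,
      hval p3 inferInstance a3, hval p4 inferInstance a4,
      ← integral_sub (hint p1 inferInstance) (hint p2 inferInstance),
      ← integral_sub (hint p3 inferInstance) (hint p4 inferInstance), ← integral_const_mul,
      ← integral_add]
    rotate_left
    · exact (hint p1 inferInstance).sub (hint p2 inferInstance)
    · exact ((hint p3 inferInstance).sub (hint p4 inferInstance)).const_mul _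
    refine integral_congr_ae (Eventually.of_forall fun τ => ?_)
    simp only
    ring

/-- The positive and negative parts of `f dτ` may be replaced by the measures with densities `f⁺` and
`f⁻`: integrals against a difference of finite measures depend on the difference only. -/
theorem integral_jordan_withDensity {f : ℝ → ℝ} (hf : Integrable f) {u : ℝ → ℂ}
    (hu : Continuous u) (hub : ∃ C : ℝ, ∀ t, ‖u t‖ ≤ C) :
    (∫ τ, u τ ∂((SignedMeasure.toJordanDecomposition (volume.withDensityᵥ f)).posPart))
      - ∫ τ, u τ ∂((SignedMeasure.toJordanDecomposition (volume.withDensityᵥ f)).negPart)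
      = ∫ τ, (f τ : ℂ) * u τ := by
  obtain ⟨C, hC⟩ := hub
  set p := (SignedMeasure.toJordanDecomposition (volume.withDensityᵥ f)).posPart
  set q := (SignedMeasure.toJordanDecomposition (volume.withDensityᵥ f)).negPart
  set P := volume.withDensity fun x => ENNReal.ofReal (f x) with hP
  set Q := volume.withDensity fun x => ENNReal.ofReal (-f x) with hQ
  have : IsFiniteMeasure P := isFiniteMeasure_withDensity_ofReal hf.2
  have : IsFiniteMeasure Q := isFiniteMeasure_withDensity_ofReal hf.neg.2
  have h1 : volume.withDensityᵥ f = p.toSignedMeasure - q.toSignedMeasure :=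
    (SignedMeasure.toSignedMeasure_toJordanDecomposition _).symm
  have h2 : volume.withDensityᵥ f = P.toSignedMeasure - Q.toSignedMeasure :=
    withDensityᵥ_eq_withDensity_pos_part_sub_withDensity_neg_part hf
  have h3 : p + Q = P + q := by
    rw [← Measure.toSignedMeasure_eq_toSignedMeasure_iff, Measure.toSignedMeasure_add,
      Measure.toSignedMeasure_add, ← sub_eq_sub_iff_add_eq_add, ← h1, ← h2]
  have hi : ∀ r : Measure ℝ, IsFiniteMeasure r → Integrable u r := fun r _ =>
    Integrable.of_bound hu.aestronglyMeasurable C (Eventually.of_forall hC)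
  have h4 : (∫ τ, u τ ∂p) + ∫ τ, u τ ∂Q = (∫ τ, u τ ∂P) + ∫ τ, u τ ∂q := by
    rw [← integral_add_measure (hi _ inferInstance) (hi _ inferInstance), h3,
      integral_add_measure (hi _ inferInstance) (hi _ inferInstance)]
  have h5 : (∫ τ, u τ ∂p) - ∫ τ, u τ ∂q = (∫ τ, u τ ∂P) - ∫ τ, u τ ∂Q := by
    linear_combination h4
  have hd : ∀ g : ℝ → ℝ, Integrable g → ∫ τ, u τ ∂(volume.withDensity fun x => ENNReal.ofReal (g x))
      = ∫ τ, ((max (g τ) 0 : ℝ) : ℂ) * u τ := fun g hg => by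
    rw [integral_withDensity_eq_integral_toReal_smul₀ hg.aemeasurable.ennreal_ofReal
      (Eventually.of_forall fun _ => ENNReal.ofReal_lt_top)]
    refine integral_congr_ae (Eventually.of_forall fun τ => ?_)
    simp only [Complex.real_smul, ENNReal.toReal_ofReal']
  rw [h5, hP, hQ, hd f hf, hd (fun x => -f x) hf.neg, ← integral_sub]
  · refine integral_congr_ae (Eventually.of_forall fun τ => ?_)
    simp only
    rw [← sub_mul, ← Complex.ofReal_sub, max_zero_sub_eq_self]
  · exact (hf.pos_part.ofReal (𝕜 := ℂ)).mul_bdd (c := C) hu.aestronglyMeasurable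
      (Eventually.of_forall hC)
  · exact (hf.neg.pos_part.ofReal (𝕜 := ℂ)).mul_bdd (c := C) hu.aestronglyMeasurable
      (Eventually.of_forall hC)

/-- The complex measure `u(τ) dτ`, for integrable `u`. (The real or the imaginary part is replaced by
zero if it is not integrable.) -/
def densityMeasure (u : ℝ → ℂ) : ComplexMeasure ℝ :=
  SignedMeasure.toComplexMeasure (volume.withDensityᵥ fun τ => (u τ).re)
    (volume.withDensityᵥ fun τ => (u τ).im)

theorem hasDensity_densityMeasure {u : ℝ → ℂ} (hu : Integrable u) :
    HasDensity (densityMeasure u) volume u := by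
  refine ⟨hu, fun v hv hvb => ?_⟩
  unfold cintegral densityMeasure
  rw [SignedMeasure.re_toComplexMeasure, SignedMeasure.im_toComplexMeasure,
    integral_jordan_withDensity (f := fun τ => (u τ).re) hu.re hv hvb,
    integral_jordan_withDensity (f := fun τ => (u τ).im) hu.im hv hvb]
  obtain ⟨C, hC⟩ := hvb
  have h1 : Integrable fun τ => (((u τ).re : ℝ) : ℂ) * v τ :=
    (hu.re.ofReal (𝕜 := ℂ)).mul_bdd (c := C) hv.aestronglyMeasurable (Eventually.of_forall hC)
  have h2 : Integrable fun τ => (((u τ).im : ℝ) : ℂ) * v τ :=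
    (hu.im.ofReal (𝕜 := ℂ)).mul_bdd (c := C) hv.aestronglyMeasurable (Eventually.of_forall hC)
  rw [← integral_const_mul, ← integral_add h1 (h2.const_mul _)]
  refine integral_congr_ae (Eventually.of_forall fun τ => ?_)
  simp only
  rw [← mul_assoc, ← add_mul]
  congr 1
  rw [mul_comm Complex.I, Complex.re_add_im]

namespace HasDensity

variable {μ : ComplexMeasure ℝ} {m : Measure ℝ} {D : ℝ → ℂ}

theorem measureHat_eq (hD : HasDensity μ m D) (ν : ℝ) :
    measureHat μ ν = ∫ τ, D τ * Complex.exp (-Complex.I * ν * τ) ∂m :=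
  hD.cintegral_eq _ (by fun_prop) ⟨1, fun τ => (norm_exp_neg_I_mul ν τ).le⟩

theorem conv_eq (hD : HasDensity μ m D) {φ : ℝ → ℂ} (hφ : φ ∈ Cb) (t : ℝ) :
    conv μ φ t = ∫ τ, D τ * φ (t - τ) ∂m :=
  hD.cintegral_eq _ (hφ.1.continuous.comp (by fun_prop))
    (hφ.2.imp fun _ hC τ => hC (t - τ))

end HasDensity

theorem measureHat_densityMeasure {u : ℝ → ℂ} (hu : Integrable u) :
    measureHat (densityMeasure u) = fourierFun u := by
  ext ν
  rw [(hasDensity_densityMeasure hu).measureHat_eq]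
  exact integral_congr_ae (Eventually.of_forall fun τ => mul_comm _ _)

theorem continuous_measureHat (μ : ComplexMeasure ℝ) : Continuous (measureHat μ) := by
  obtain ⟨m, D, hm, hD⟩ := exists_hasDensity μ
  rw [funext hD.measureHat_eq]
  refine continuous_of_dominated (bound := fun τ => ‖D τ‖) (fun ν => ?_)
    (fun ν => Eventually.of_forall fun τ => ?_)
    hD.integrable.norm (Eventually.of_forall fun τ => by fun_prop)
  · exact hD.integrable.aestronglyMeasurable.mul (by fun_prop)
  · rw [norm_mul, norm_exp_neg_I_mul, mul_one]

theorem exists_norm_measureHat_le (μ : ComplexMeasure ℝ) : ∃ C : ℝ, ∀ ν, ‖measureHat μ ν‖ ≤ C := by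
  obtain ⟨m, D, hm, hD⟩ := exists_hasDensity μ
  refine ⟨∫ τ, ‖D τ‖ ∂m, fun ν => ?_⟩
  rw [hD.measureHat_eq]
  refine (norm_integral_le_integral_norm _).trans (le_of_eq ?_)
  simp only [norm_mul, norm_exp_neg_I_mul, mul_one]

/-! ### Convolution of bounded functions with complex measures -/

theorem conv_mem_Cb (μ : ComplexMeasure ℝ) {φ : ℝ → ℂ} (hφ : φ ∈ Cb) : conv μ φ ∈ Cb := by
  obtain ⟨m, D, hm, hD⟩ := exists_hasDensity μ
  rw [funext (hD.conv_eq hφ)]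
  obtain ⟨huc, C, hC⟩ := hφ
  have hint : ∀ t, Integrable (fun τ => D τ * φ (t - τ)) m := fun t =>
    hD.integrable.mul_bdd (c := C) (huc.continuous.comp (by fun_prop)).aestronglyMeasurable
      (Eventually.of_forall fun τ => hC _)
  refine ⟨?_, (∫ τ, ‖D τ‖ ∂m) * C, fun t => ?_⟩
  · rw [Metric.uniformContinuous_iff] at huc ⊢
    intro ε hε
    have hI : 0 ≤ ∫ τ, ‖D τ‖ ∂m := integral_nonneg fun _ => norm_nonneg _
    obtain ⟨δ, hδ, h⟩ := huc (ε / ((∫ τ, ‖D τ‖ ∂m) + 1)) (by positivity)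
    refine ⟨δ, hδ, fun {s t} hst => ?_⟩
    rw [dist_eq_norm, ← integral_sub (hint s) (hint t)]
    calc ‖∫ τ, (D τ * φ (s - τ) - D τ * φ (t - τ)) ∂m‖
        ≤ ∫ τ, ‖D τ‖ * (ε / ((∫ τ, ‖D τ‖ ∂m) + 1)) ∂m := by
          refine norm_integral_le_of_norm_le (hD.integrable.norm.mul_const _)
            (Eventually.of_forall fun τ => ?_)
          rw [← mul_sub, norm_mul]
          gcongr
          rw [← dist_eq_norm]
          exact (h (by simpa using hst)).le
      _ = (∫ τ, ‖D τ‖ ∂m) * (ε / ((∫ τ, ‖D τ‖ ∂m) + 1)) := integral_mul_const _ _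
      _ < ε := by
          rw [mul_div_assoc', div_lt_iff₀ (by positivity)]
          nlinarith
  · refine (norm_integral_le_of_norm_le (hD.integrable.norm.mul_const C)
      (Eventually.of_forall fun τ => ?_)).trans_eq (integral_mul_const _ _)
    rw [norm_mul]
    gcongr
    exact hC _

theorem conv_mem_C0 (μ : ComplexMeasure ℝ) {l : Filter ℝ} [l.IsCountablyGenerated]
    (hl : ∀ τ : ℝ, Tendsto (fun t => t - τ) l l) {φ : ℝ → ℂ} (hφ : φ ∈ C0 l) :
    conv μ φ ∈ C0 l := by
  refine ⟨conv_mem_Cb μ hφ.1, ?_⟩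
  obtain ⟨m, D, hm, hD⟩ := exists_hasDensity μ
  rw [funext (hD.conv_eq hφ.1)]
  obtain ⟨⟨huc, C, hC⟩, h0⟩ := hφ
  rw [← integral_zero ℝ ℂ (μ := m)]
  refine tendsto_integral_filter_of_dominated_convergence (fun τ => ‖D τ‖ * C)
    (Eventually.of_forall fun t => hD.integrable.aestronglyMeasurable.mul
      (huc.continuous.comp (by fun_prop)).aestronglyMeasurable)
    (Eventually.of_forall fun t => Eventually.of_forall fun τ => ?_)
    (hD.integrable.norm.mul_const C) (Eventually.of_forall fun τ => ?_)
  · rw [norm_mul]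
    gcongr
    exact hC _
  · simpa using (h0.comp (hl τ)).const_mul (D τ)

/-- Functions of Wiener's algebra: continuous, integrable, with an integrable Fourier transform. -/
structure InWiener (h : ℝ → ℂ) : Prop where
  continuous : Continuous h
  integrable : Integrable h
  integrable_fourierFun : Integrable (fourierFun h)

theorem inWiener_schwartz (h : 𝓢(ℝ, ℂ)) : InWiener h :=
  ⟨h.continuous, h.integrable, integrable_fourierFun_schwartz h⟩

theorem HasDensity.fourierFun_measureHat_mul {μ : ComplexMeasure ℝ} {m : Measure ℝ} [SFinite m]
    {D : ℝ → ℂ} (hD : HasDensity μ m D) {h : ℝ → ℂ} (hh : Integrable h) (t : ℝ) :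
    fourierFun (fun ν => measureHat μ ν * h ν) t = ∫ τ, D τ * fourierFun h (t + τ) ∂m := by
  have h1 : ∀ ν : ℝ, Complex.exp (-Complex.I * t * ν) * (measureHat μ ν * h ν)
      = ∫ τ, Complex.exp (-Complex.I * (t + τ) * ν) * (h ν * D τ) ∂m := fun ν => by
    rw [hD.measureHat_eq, mul_left_comm, ← integral_mul_const]
    refine integral_congr_ae (Eventually.of_forall fun τ => ?_)
    simp only
    rw [show -Complex.I * (t + τ) * ν = -Complex.I * t * ν + -Complex.I * ν * τ by ring,
      Complex.exp_add]
    ring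
  have h2 : ∀ τ : ℝ, D τ * fourierFun h (t + τ)
      = ∫ ν : ℝ, Complex.exp (-Complex.I * (t + τ) * ν) * (h ν * D τ) := fun τ => by
    rw [fourierFun, ← integral_const_mul]
    refine integral_congr_ae (Eventually.of_forall fun ν => ?_)
    push_cast
    ring
  simp_rw [h2]
  rw [fourierFun]
  simp_rw [h1]
  refine integral_integral_swap ?_
  refine (hh.mul_prod hD.integrable).bdd_mul (c := 1) ?_ (Eventually.of_forall fun p => ?_)
  · exact Continuous.aestronglyMeasurable (by fun_prop)
  · have := norm_exp_neg_I_mul (t + p.2) p.1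
    push_cast at this
    exact this.le

theorem HasDensity.integrable_conv_kernel {μ : ComplexMeasure ℝ} {m : Measure ℝ} [SFinite m]
    {D : ℝ → ℂ} (hD : HasDensity μ m D) {k : ℝ → ℂ} (hk : Integrable k) :
    Integrable (Function.uncurry fun t τ => D τ * k (t + τ)) (volume.prod m) := by
  have h := (measurePreserving_prod_add m volume).integrable_comp_of_integrable
    (hD.integrable.mul_prod hk)
  refine (h.swap).congr (Eventually.of_forall fun p => ?_)
  simp [Function.uncurry, add_comm]

/-- Wiener's algebra is a module over the Fourier transforms of complex measures. -/
theorem InWiener.measureHat_mul (μ : ComplexMeasure ℝ) {h : ℝ → ℂ} (hh : InWiener h) :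
    InWiener fun ν => measureHat μ ν * h ν := by
  obtain ⟨C, hC⟩ := exists_norm_measureHat_le μ
  refine ⟨(continuous_measureHat μ).mul hh.continuous, hh.integrable.bdd_mul (c := C)
    (continuous_measureHat μ).aestronglyMeasurable (Eventually.of_forall hC), ?_⟩
  obtain ⟨m, D, hm, hD⟩ := exists_hasDensity μ
  rw [funext (hD.fourierFun_measureHat_mul hh.integrable)]
  exact (hD.integrable_conv_kernel hh.integrable_fourierFun).integral_prod_left

/-- The product of a bounded function's Fourier transform with the one of a measure, tested on a
function from Wiener's algebra: convolution with `μ` is dual to multiplication by `μ̂`. -/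
theorem integral_conv_mul_fourierFun (μ : ComplexMeasure ℝ) {φ : ℝ → ℂ} (hφ : φ ∈ Cb) {h : ℝ → ℂ}
    (hh : InWiener h) : ∫ t, conv μ φ t * fourierFun h t
      = ∫ t, φ t * fourierFun (fun ν => measureHat μ ν * h ν) t := by
  obtain ⟨m, D, hm, hD⟩ := exists_hasDensity μ
  rw [funext (hD.fourierFun_measureHat_mul hh.integrable), funext (hD.conv_eq hφ)]
  obtain ⟨huc, C, hC⟩ := hφ
  have hk := hD.integrable_conv_kernel hh.integrable_fourierFun
  have hint : Integrable (Function.uncurry fun t τ => φ t * (D τ * fourierFun h (t + τ)))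
      (volume.prod m) :=
    hk.bdd_mul (c := C) (huc.continuous.comp continuous_fst).aestronglyMeasurable
      (Eventually.of_forall fun p => hC _)
  have hk' : Integrable (Function.uncurry fun τ t => D τ * φ (t - τ) * fourierFun h t)
      (m.prod volume) := by
    refine ((hD.integrable.mul_prod hh.integrable_fourierFun).bdd_mul (c := C)
      (f := fun p : ℝ × ℝ => φ (p.2 - p.1)) ?_ (Eventually.of_forall fun p => hC _)).congr
      (Eventually.of_forall fun p => ?_)
    · exact (huc.continuous.comp (by fun_prop)).aestronglyMeasurable
    · simp only [Function.uncurry]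
      ring
  simp_rw [← integral_const_mul, ← integral_mul_const]
  rw [integral_integral_swap hint, ← integral_integral_swap hk']
  refine integral_congr_ae (Eventually.of_forall fun τ => ?_)
  simp only
  rw [← integral_add_right_eq_self _ τ]
  refine integral_congr_ae (Eventually.of_forall fun t => ?_)
  simp only [add_sub_cancel_right]
  ring

/-! ### Weak limits in `L²` and products with a truncated function -/

/-- A bounded sequence in `L²(ℝ)` converges weakly along some ultrafilter finer than `atTop`. -/
theorem exists_weak_limit (F : ℕ → ℝ → ℂ) (hF : ∀ n, MemLp (F n) 2) (C : NNReal)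
    (hC : ∀ n, eLpNorm (F n) 2 volume ≤ C) :
    ∃ (U : Filter ℕ) (g : ℝ → ℂ), U.NeBot ∧ U ≤ atTop ∧ MemLp g 2 ∧
      ∀ v : ℝ → ℂ, MemLp v 2 → Tendsto (fun n => ∫ ν, F n ν * v ν) U (𝓝 (∫ ν, g ν * v ν)) := by
  have hFs : ∀ n, MemLp (fun ν => star (F n ν)) 2 := fun n => (hF n).star
  let L := Lp ℂ 2 (volume : Measure ℝ)
  let T : ℕ → WeakDual ℂ L := fun n =>
    StrongDual.toWeakDual (InnerProductSpace.toDual ℂ L (hFs n).toLp)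
  have hT : ∀ n, T n ∈ WeakDual.toStrongDual ⁻¹' Metric.closedBall (0 : StrongDual ℂ L) C := by
    intro n
    rw [Set.mem_preimage, mem_closedBall_zero_iff]
    change ‖InnerProductSpace.toDual ℂ L (hFs n).toLp‖ ≤ C
    rw [LinearIsometryEquiv.norm_map, Lp.norm_toLp]
    refine ENNReal.toReal_le_coe_of_le_coe ((le_of_eq ?_).trans (hC n))
    exact eLpNorm_congr_norm_ae (Eventually.of_forall fun ν => norm_star _)
  obtain ⟨x, -, hx⟩ := (WeakDual.isCompact_closedBall (0 : StrongDual ℂ L) (C : ℝ)).ultrafilter_le_nhds'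
    ((hyperfilter ℕ).map T) (Ultrafilter.mem_map.2 (univ_mem' hT))
  set y : L := (InnerProductSpace.toDual ℂ L).symm (WeakDual.toStrongDual x) with hy
  refine ⟨(hyperfilter ℕ : Filter ℕ), fun ν => star (y ν), inferInstance, ?_,
    (Lp.memLp y).star, fun v hv => ?_⟩
  · rw [← Nat.cofinite_eq_atTop]
    exact hyperfilter_le_cofinite
  · have h1 : Tendsto T (hyperfilter ℕ) (𝓝 x) := hx
    have h2 := ((WeakDual.eval_continuous (hv.toLp : L)).tendsto x).comp h1
    have h3 : x (hv.toLp : L) = ∫ ν, star (y ν) * v ν := by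
      have : x (hv.toLp : L) = inner ℂ y (hv.toLp : L) := by
        rw [hy, InnerProductSpace.toDual_symm_apply]
        rfl
      rw [this, L2.inner_def]
      refine integral_congr_ae ?_
      filter_upwards [hv.coeFn_toLp] with ν hν
      rw [hν, RCLike.inner_apply, mul_comm]
      rfl
    have h4 : ∀ n, T n (hv.toLp : L) = ∫ ν, F n ν * v ν := by
      intro n
      have : T n (hv.toLp : L) = inner ℂ ((hFs n).toLp : L) (hv.toLp : L) := rfl
      rw [this, L2.inner_def]
      refine integral_congr_ae ?_
      filter_upwards [hv.coeFn_toLp, (hFs n).coeFn_toLp] with ν hν hν'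
      rw [hν, hν', RCLike.inner_apply, mul_comm]
      simp
    rw [← h3]
    refine h2.congr fun n => ?_
    exact h4 n

/-- The restriction of `ψ` to the window `(-n, n]`. -/
def window (ψ : ℝ → ℂ) (n : ℕ) : ℝ → ℂ := Set.indicator (Set.Ioc (-(n : ℝ)) n) ψ

theorem integrable_window {ψ : ℝ → ℂ} (hψ : Continuous ψ) (n : ℕ) : Integrable (window ψ n) :=
  (integrable_indicator_iff measurableSet_Ioc).2
    (hψ.integrableOn_Icc.mono_set Set.Ioc_subset_Icc_self)

theorem norm_window_le (ψ : ℝ → ℂ) (n : ℕ) (t : ℝ) : ‖window ψ n t‖ ≤ ‖ψ t‖ :=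
  norm_indicator_le_norm_self _ _

theorem tendsto_window (ψ : ℝ → ℂ) (t : ℝ) :
    Tendsto (fun n => window ψ n t) atTop (𝓝 (ψ t)) := by
  refine tendsto_const_nhds.congr' ?_
  obtain ⟨N, hN⟩ := exists_nat_gt |t|
  filter_upwards [eventually_ge_atTop N] with n hn
  have : |t| < n := hN.trans_le (by exact_mod_cast hn)
  rw [window, Set.indicator_of_mem]
  exact ⟨(abs_lt.1 this).1, (abs_lt.1 this).2.le⟩

theorem fourierFun_window (ψ : ℝ → ℂ) (n : ℕ) (ν : ℝ) :
    fourierFun (window ψ n) ν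
      = ∫ s in (-(n : ℝ))..n, Complex.exp (-Complex.I * ν * s) * ψ s := by
  have hn : (0 : ℝ) ≤ n := n.cast_nonneg
  rw [intervalIntegral.integral_of_le (by linarith), ← integral_indicator measurableSet_Ioc,
    fourierFun]
  refine integral_congr_ae (Eventually.of_forall fun s => ?_)
  simp only [window, Set.indicator]
  split_ifs <;> simp

theorem tendsto_integral_window_mul {ψ : ℝ → ℂ} (hψ : ψ ∈ Cb) {k : ℝ → ℂ} (hk : Integrable k) :
    Tendsto (fun n => ∫ t, window ψ n t * k t) atTop (𝓝 (∫ t, ψ t * k t)) := by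
  obtain ⟨huc, C, hC⟩ := hψ
  refine tendsto_integral_of_dominated_convergence (fun t => C * ‖k t‖)
    (fun n => (integrable_window huc.continuous n).aestronglyMeasurable.mul hk.aestronglyMeasurable)
    (hk.norm.const_mul C) (fun n => Eventually.of_forall fun t => ?_)
    (Eventually.of_forall fun t => (tendsto_window ψ t).mul_const _)
  rw [norm_mul]
  gcongr
  exact (norm_window_le ψ n t).trans (hC t)

/-- The distribution `μ̂ ψ̂` is the limit of the functions `μ̂ F(ψ 1_{(-n, n]})`. -/
theorem tendsto_integral_measureHat_mul_window (μ : ComplexMeasure ℝ) {ψ : ℝ → ℂ} (hψ : ψ ∈ Cb)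
    (h : 𝓢(ℝ, ℂ)) :
    Tendsto (fun n => ∫ ν, (measureHat μ ν * fourierFun (window ψ n) ν) * h ν) atTop
      (𝓝 (hat (conv μ ψ) h)) := by
  have hW := (inWiener_schwartz h).measureHat_mul μ
  rw [hat_apply (memLp_top_of_mem_Cb (conv_mem_Cb μ hψ)),
    integral_conv_mul_fourierFun μ hψ (inWiener_schwartz h)]
  refine (tendsto_integral_window_mul hψ hW.integrable_fourierFun).congr fun n => ?_
  rw [← integral_fourierFun_mul (integrable_window hψ.1.continuous n) hW.integrable]
  exact integral_congr_ae (Eventually.of_forall fun ν => by ring)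

/-- If the truncated products `μ̂ F(ψ 1_{(-n, n]})` are bounded in `L²`, then the distribution
`μ̂ ψ̂` is given by a function `g ∈ L²`, and `c μ̂ ψ̂` is given by `c g` for `c ∈ L²`. -/
theorem exists_memLp_two_hat_conv (μ : ComplexMeasure ℝ) {ψ : ℝ → ℂ} (hψ : ψ ∈ Cb) (C : NNReal)
    (hC : ∀ n : ℕ, eLpNorm (fun ν => measureHat μ ν * fourierFun (window ψ n) ν) 2 volume ≤ C) :
    ∃ g : ℝ → ℂ, MemLp g 2 ∧ (∀ h : 𝓢(ℝ, ℂ), hat (conv μ ψ) h = ∫ ν, g ν * h ν) ∧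
      ∀ (μ' : ComplexMeasure ℝ) (c : ℝ → ℂ), MemLp c 2 →
        (∀ ν, measureHat μ' ν = c ν * measureHat μ ν) →
        ∀ h : 𝓢(ℝ, ℂ), hat (conv μ' ψ) h = ∫ ν, (g ν * c ν) * h ν := by
  obtain ⟨U, g, hU, hUle, hg, hlim⟩ := exists_weak_limit
    (fun n ν => measureHat μ ν * fourierFun (window ψ n) ν)
    (fun n => ⟨((continuous_measureHat μ).mul
      (continuous_fourierFun (integrable_window hψ.1.continuous n))).aestronglyMeasurable,
      (hC n).trans_lt ENNReal.coe_lt_top⟩) C hC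
  refine ⟨g, hg, fun h => ?_, fun μ' c hc hμ' h => ?_⟩
  · exact tendsto_nhds_unique ((tendsto_integral_measureHat_mul_window μ hψ h).mono_left hUle)
      (hlim h (h.memLp 2 volume))
  · have hch : MemLp (fun ν => c ν * h ν) 2 := MemLp.mul (p := 2) (q := ∞) (h.memLp ∞ volume) hc
    have h1 := hlim _ hch
    have h2 := (tendsto_integral_measureHat_mul_window μ' hψ h).mono_left hUle
    refine (tendsto_nhds_unique h2 (h1.congr fun n => ?_)).trans ?_
    · refine integral_congr_ae (Eventually.of_forall fun ν => ?_)
      simp only [hμ']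
      ring
    · exact integral_congr_ae (Eventually.of_forall fun ν => by ring)

theorem isLp_of_forall_apply {p : ℝ≥0∞} [Fact (1 ≤ p)] {T : 𝓢'(ℝ, ℂ)} {g : ℝ → ℂ}
    (hg : MemLp g p) (h : ∀ k : 𝓢(ℝ, ℂ), T k = ∫ ν, g ν * k ν) : IsLp p T := by
  refine ⟨hg.toLp, ?_⟩
  ext k
  rw [h, Lp.toTemperedDistribution_apply]
  refine integral_congr_ae ?_
  filter_upwards [hg.coeFn_toLp] with ν hν
  rw [hν, smul_eq_mul, mul_comm]

/-! ### Decay of square integrable functions and the singular support -/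

instance : (cocompact ℝ).IsCountablyGenerated := by
  rw [cocompact_eq_atBot_atTop]
  infer_instance

/-- A uniformly continuous square integrable function tends to zero at infinity. -/
theorem tendsto_zero_of_memLp_two {χ : ℝ → ℂ} (huc : UniformContinuous χ) (hχ : MemLp χ 2) :
    Tendsto χ (cocompact ℝ) (𝓝 0) := by
  have hsq := (memLp_two_iff_integrable_sq_norm hχ.1).1 hχ
  rw [Metric.tendsto_nhds]
  intro ε hε
  obtain ⟨δ, hδ, h⟩ := Metric.uniformContinuous_iff.1 huc (ε / 2) (by positivity)
  -- the mass of `‖χ‖²` in the window `(t, t + δ/2)` vanishes as `|t| → ∞`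
  have h1 : Tendsto (fun t => ∫ s, (Set.Ioo t (t + δ / 2)).indicator (fun s => ‖χ s‖ ^ 2) s)
      (cocompact ℝ) (𝓝 (∫ s : ℝ, (0 : ℝ))) := by
    refine tendsto_integral_filter_of_dominated_convergence (fun s => ‖χ s‖ ^ 2)
      (Eventually.of_forall fun t => hsq.aestronglyMeasurable.indicator measurableSet_Ioo)
      (Eventually.of_forall fun t => Eventually.of_forall fun s => ?_) hsq
      (Eventually.of_forall fun s => ?_)
    · refine (norm_indicator_le_norm_self _ _).trans ?_
      simp
    · refine tendsto_const_nhds.congr' ?_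
      have : (Set.Icc (s - δ / 2) s)ᶜ ∈ cocompact ℝ := isCompact_Icc.compl_mem_cocompact
      filter_upwards [this] with t ht
      rw [Set.indicator_of_notMem]
      intro hs
      exact ht ⟨by linarith [hs.2], hs.1.le⟩
  rw [integral_zero] at h1
  have h2 : 0 < (ε / 2) ^ 2 * (δ / 2) := by positivity
  filter_upwards [h1.eventually (gt_mem_nhds h2)] with t ht
  rw [dist_zero_right]
  by_contra hcon
  push Not at hcon
  refine absurd ht (not_lt.2 ?_)
  rw [integral_indicator measurableSet_Ioo]
  have h3 : ∫ s in Set.Ioo t (t + δ / 2), (ε / 2) ^ 2 = (ε / 2) ^ 2 * (δ / 2) := by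
    rw [setIntegral_const, smul_eq_mul, mul_comm, Measure.real, Real.volume_Ioo,
      ENNReal.toReal_ofReal (by linarith)]
    ring
  rw [← h3]
  refine setIntegral_mono_on (integrableOn_const (by simp)) hsq.integrableOn
    measurableSet_Ioo fun s hs => ?_
  have h4 : dist (χ s) (χ t) < ε / 2 := h (by
    rw [Real.dist_eq, abs_lt]; constructor <;> linarith [hs.1, hs.2])
  have h5 : ‖χ t‖ ≤ ‖χ s‖ + dist (χ s) (χ t) := by
    rw [dist_comm, dist_eq_norm]
    calc ‖χ t‖ = ‖χ s + (χ t - χ s)‖ := by congr 1; ring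
      _ ≤ _ := norm_add_le _ _
  gcongr
  linarith

/-- If `a = μ̂` is continuously differentiable and `μ * ψ` tends to zero along `l`, then `a` vanishes
on the singular support of `ψ̂` along `l`: near a point where `a ≠ 0`, the Fourier
transform `k` of a measure is the product of `a`, `k` and `θ / a`, where `θ` is a smooth cutoff, and
`θ / a` is the Fourier transform of an integrable function. -/
theorem notMem_singSuppAlong {l : Filter ℝ} [l.IsCountablyGenerated]
    (hl : ∀ τ : ℝ, Tendsto (fun t => t - τ) l l) {a : ℝ → ℝ} (ha : ContDiff ℝ 1 a)
    (μ : ComplexMeasure ℝ) (hμ : ∀ ν, measureHat μ ν = a ν) {ψ : ℝ → ℂ} (hψ : ψ ∈ Cb)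
    (hχ : conv μ ψ ∈ C0 l) {s : ℝ} (hs : a s ≠ 0) : s ∉ singSuppAlong l (hat ψ) := by
  have hopen : {ν | a ν ≠ 0} ∈ 𝓝 s := ha.continuous.continuousAt.eventually_ne hs
  obtain ⟨r, hr, hball⟩ := Metric.nhds_basis_closedBall.mem_iff.1 hopen
  let θ : ContDiffBump s := ⟨r / 2, r, by positivity, by linarith⟩
  set u : ℝ → ℂ := fun ν => ((θ ν * (a ν)⁻¹ : ℝ) : ℂ) with hu
  have hcs : HasCompactSupport u :=
    θ.hasCompactSupport.mono' (fun ν hν => subset_closure fun h0 => hν (by simp [hu, h0]))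
  have hud : ContDiff ℝ 1 u := by
    refine Complex.ofRealCLM.contDiff.comp (contDiff_iff_contDiffAt.2 fun ν => ?_)
    by_cases hν : a ν = 0
    · have h1 : ν ∉ tsupport θ := by
        rw [θ.tsupport_eq]
        exact fun hmem => hball hmem hν
      refine (contDiffAt_const (c := (0 : ℝ))).congr_of_eventuallyEq ?_
      filter_upwards [notMem_tsupport_iff_eventuallyEq.1 h1] with x hx
      change θ x * (a x)⁻¹ = 0
      rw [hx]
      simp
    · exact θ.contDiff.contDiffAt.mul (ha.contDiffAt.inv hν)
  have hudc : Continuous (deriv u) := hud.continuous_deriv le_rfl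
  have hui : Integrable (fourierFun u) := integrable_fourierFun_of_deriv
    (hud.differentiable (by norm_num)) (hud.continuous.integrable_of_hasCompactSupport hcs)
    (hud.continuous.memLp_of_hasCompactSupport hcs)
    (hudc.integrable_of_hasCompactSupport hcs.deriv) (hudc.memLp_of_hasCompactSupport hcs.deriv)
  have hq := integrable_fourierInvFun hui
  have hqhat : measureHat (densityMeasure (fourierInvFun u)) = u := by
    rw [measureHat_densityMeasure hq, fourierFun_fourierInvFun hud.continuous
      (hud.continuous.integrable_of_hasCompactSupport hcs) hui]
  intro hmem
  refine hmem ⟨s - r / 2, s + r / 2, ⟨by linarith, by linarith⟩, ?_⟩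
  rintro k ⟨μk, rfl⟩ hk
  refine ⟨hat (conv μk ψ), ?_, μk, ψ, hψ, rfl, rfl, rfl⟩
  refine ⟨conv (densityMeasure (fourierInvFun u)) (conv μk (conv μ ψ)),
    conv_mem_C0 _ hl (conv_mem_C0 _ hl hχ), ?_⟩
  ext h
  have hχ' := conv_mem_Cb μ hψ
  have hχ'' := conv_mem_Cb μk hχ'
  have hW := (inWiener_schwartz h).measureHat_mul (densityMeasure (fourierInvFun u))
  rw [hat_apply (memLp_top_of_mem_Cb (conv_mem_Cb _ hχ'')),
    hat_apply (memLp_top_of_mem_Cb (conv_mem_Cb μk hψ)),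
    integral_conv_mul_fourierFun _ hχ'' (inWiener_schwartz h),
    integral_conv_mul_fourierFun _ hχ' hW,
    integral_conv_mul_fourierFun _ hψ (hW.measureHat_mul μk),
    integral_conv_mul_fourierFun _ hψ (inWiener_schwartz h)]
  suffices hkey : (fun ν => measureHat μ ν * (measureHat μk ν
      * (measureHat (densityMeasure (fourierInvFun u)) ν * h ν))) = fun ν => measureHat μk ν * h ν by
    rw [hkey]
  ext ν
  simp only [hμ, hqhat]
  by_cases hν : measureHat μk ν = 0
  · simp [hν]
  · have h1 : ν ∈ Set.Ioo (s - r / 2) (s + r / 2) := hk (subset_closure hν)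
    have h2 : ν ∈ Metric.closedBall s (r / 2) := by
      rw [Real.closedBall_eq_Icc]; exact Set.Ioo_subset_Icc_self h1
    have h3 : θ ν = 1 := θ.one_of_mem_closedBall h2
    have h4 : (a ν : ℂ) ≠ 0 := by
      exact_mod_cast hball (Metric.closedBall_subset_closedBall (by linarith) h2)
    simp only [hu, h3, one_mul, Complex.ofReal_inv]
    field_simp

/-! ### The forced oscillators and their energy -/

/-- The complex amplitude `√ρ (ξ̇ + i ν ξ)` of the oscillator of frequency `ν` at time `t`, in
closed form: `Z₀` is its value at time zero, `a = κ / √ρ` and `ψ` is the force. -/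
def oscAmp (a ψ : ℝ → ℝ) (Z₀ : ℝ → ℂ) (ν t : ℝ) : ℂ :=
  Complex.exp (Complex.I * ν * t)
    * (Z₀ ν + a ν * ∫ s in (0 : ℝ)..t, Complex.exp (-Complex.I * ν * s) * ψ s)

/-- The amplitude of an oscillator relative to the equilibrium that it has under the constant force
of magnitude `ψ(t)`. -/
def oscShift (a ψ : ℝ → ℝ) (Z₀ : ℝ → ℂ) (ν t : ℝ) : ℂ :=
  oscAmp a ψ Z₀ ν t - Complex.I * ((a ν / ν : ℝ) : ℂ) * ψ t

theorem exp_neg_mul_exp (ν t : ℝ) :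
    Complex.exp (-Complex.I * ν * t) * Complex.exp (Complex.I * ν * t) = 1 := by
  rw [← Complex.exp_add]
  simp

theorem hasDerivAt_cexp_mul (c : ℂ) (t : ℝ) :
    HasDerivAt (fun t : ℝ => Complex.exp (c * t)) (c * Complex.exp (c * t)) t := by
  have h := ((hasDerivAt_id (t : ℂ)).const_mul c).cexp.comp_ofReal
  simpa [mul_comm] using h

theorem hasDerivAt_oscAmp {a ψ : ℝ → ℝ} (hψ : Continuous ψ) (Z₀ : ℝ → ℂ) (ν t : ℝ) :
    HasDerivAt (oscAmp a ψ Z₀ ν) (Complex.I * ν * oscAmp a ψ Z₀ ν t + a ν * ψ t) t := by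
  have hc : Continuous fun s : ℝ => Complex.exp (-Complex.I * ν * s) * (ψ s : ℂ) := by fun_prop
  have h1 : HasDerivAt (fun t => Z₀ ν + a ν * ∫ s in (0 : ℝ)..t,
      Complex.exp (-Complex.I * ν * s) * ψ s)
      (a ν * (Complex.exp (-Complex.I * ν * t) * ψ t)) t :=
    ((hc.integral_hasStrictDerivAt 0 t).hasDerivAt.const_mul (a ν : ℂ)).const_add _
  have h2 := (hasDerivAt_cexp_mul (Complex.I * ν) t).mul h1
  refine h2.congr_deriv ?_
  have h3 := exp_neg_mul_exp ν t
  unfold oscAmp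
  linear_combination (a ν * ψ t : ℂ) * h3

/-- Uniqueness for the equation `ż = i ν z + a ψ`. -/
theorem eq_oscAmp {a ψ : ℝ → ℝ} (hψ : Continuous ψ) {Z₀ : ℝ → ℂ} {ν : ℝ} {z : ℝ → ℂ}
    (hz : ∀ t, HasDerivAt z (Complex.I * ν * z t + a ν * ψ t) t) (h0 : z 0 = Z₀ ν) (t : ℝ) :
    z t = oscAmp a ψ Z₀ ν t := by
  set d : ℝ → ℂ := fun t => Complex.exp (-Complex.I * ν * t) * (z t - oscAmp a ψ Z₀ ν t) with hd
  have h1 : ∀ t, HasDerivAt d 0 t := fun t => by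
    refine ((hasDerivAt_cexp_mul (-Complex.I * ν) t).mul
      ((hz t).sub (hasDerivAt_oscAmp hψ Z₀ ν t))).congr_deriv ?_
    simp only [Pi.sub_apply]
    ring
  have h2 : d t = d 0 :=
    is_const_of_deriv_eq_zero (fun t => (h1 t).differentiableAt) (fun t => (h1 t).deriv) t 0
  have h3 : d 0 = 0 := by simp [hd, h0, oscAmp]
  have h4 : z t - oscAmp a ψ Z₀ ν t = 0 := by
    rw [h3] at h2
    exact (mul_eq_zero.1 h2).resolve_left (Complex.exp_ne_zero _)
  exact sub_eq_zero.1 h4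

theorem continuous_integral_exp_mul {ψ : ℝ → ℝ} (hψ : Continuous ψ) (b t : ℝ) :
    Continuous fun ν : ℝ => ∫ s in b..t, Complex.exp (-Complex.I * ν * s) * (ψ s : ℂ) :=
  intervalIntegral.continuous_parametric_intervalIntegral_of_continuous' (by fun_prop) _ _

theorem aestronglyMeasurable_oscAmp {a ψ : ℝ → ℝ} (hψ : Continuous ψ) (ha : Continuous a)
    {Z₀ : ℝ → ℂ} (hZ : AEStronglyMeasurable Z₀ volume) (t : ℝ) :
    AEStronglyMeasurable (fun ν => oscAmp a ψ Z₀ ν t) volume := by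
  refine AEStronglyMeasurable.mul (Continuous.aestronglyMeasurable (by fun_prop)) (hZ.add ?_)
  exact ((Complex.continuous_ofReal.comp ha).mul
    (continuous_integral_exp_mul hψ 0 t)).aestronglyMeasurable

theorem hasDerivAt_oscShift {a ψ : ℝ → ℝ} (hψ : ContDiff ℝ 1 ψ) (Z₀ : ℝ → ℂ) {ν : ℝ} (hν : ν ≠ 0)
    (t : ℝ) : HasDerivAt (oscShift a ψ Z₀ ν) (Complex.I * ν * oscShift a ψ Z₀ ν t
      - Complex.I * ((a ν / ν : ℝ) : ℂ) * (deriv ψ t : ℝ)) t := by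
  have h1 : HasDerivAt (fun t => (ψ t : ℂ)) ((deriv ψ t : ℝ) : ℂ) t :=
    ((hψ.differentiable (by norm_num)) t).hasDerivAt.ofReal_comp
  refine ((hasDerivAt_oscAmp hψ.continuous Z₀ ν t).sub
    (h1.const_mul (Complex.I * ((a ν / ν : ℝ) : ℂ)))).congr_deriv ?_
  have hν' : (ν : ℂ) ≠ 0 := by exact_mod_cast hν
  have h2 : (ν : ℂ) * ((a ν / ν : ℝ) : ℂ) = a ν := by
    push_cast
    field_simp
  unfold oscShift
  linear_combination (-(ψ t : ℂ)) * h2 + (ν * ((a ν / ν : ℝ) : ℂ) * ψ t : ℂ) * Complex.I_sq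

theorem hasDerivAt_half_norm_sq_oscShift {a ψ : ℝ → ℝ} (hψ : ContDiff ℝ 1 ψ) (Z₀ : ℝ → ℂ) {ν : ℝ}
    (hν : ν ≠ 0) (t : ℝ) : HasDerivAt (fun t => ‖oscShift a ψ Z₀ ν t‖ ^ 2 / 2)
      (-(deriv ψ t * (a ν / ν * (oscShift a ψ Z₀ ν t).im))) t := by
  refine ((hasDerivAt_oscShift hψ Z₀ hν t).norm_sq.div_const 2).congr_deriv ?_
  rw [Complex.inner]
  simp
  ring

/-- A bound that is uniform in time on `[-R, R]` and square integrable in `ν`. It is obtained in the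
frame rotating with the oscillator. -/
theorem norm_oscShift_le {a ψ : ℝ → ℝ} (hψ : ContDiff ℝ 1 ψ) (Z₀ : ℝ → ℂ) {ν : ℝ} (hν : ν ≠ 0)
    {R C : ℝ} (hR : 0 ≤ R) (hC : ∀ s ∈ Set.Icc (-R) R, |deriv ψ s| ≤ C) {t : ℝ}
    (ht : t ∈ Set.Icc (-R) R) :
    ‖oscShift a ψ Z₀ ν t‖ ≤ ‖oscShift a ψ Z₀ ν 0‖ + C * R * |a ν / ν| := by
  set d : ℝ → ℂ := fun t => Complex.exp (-Complex.I * ν * t) * oscShift a ψ Z₀ ν t with hd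
  have h1 : ∀ s : ℝ, HasDerivAt d (Complex.exp (-Complex.I * ν * s)
      * (-Complex.I * ((a ν / ν : ℝ) : ℂ) * (deriv ψ s : ℝ))) s := fun s => by
    refine ((hasDerivAt_cexp_mul (-Complex.I * ν) s).mul
      (hasDerivAt_oscShift hψ Z₀ hν s)).congr_deriv ?_
    ring
  have h0 : (0 : ℝ) ∈ Set.Icc (-R) R := ⟨by linarith, hR⟩
  have hC0 : 0 ≤ C := (abs_nonneg _).trans (hC 0 h0)
  have h2 : ‖d t - d 0‖ ≤ (|a ν / ν| * C) * ‖t - 0‖ := by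
    refine (convex_Icc (-R) R).norm_image_sub_le_of_norm_hasDerivWithin_le
      (fun s _ => (h1 s).hasDerivWithinAt) (fun s hs => ?_) h0 ht
    rw [norm_mul, norm_exp_neg_I_mul, one_mul, norm_mul, norm_mul, norm_neg, Complex.norm_I,
      one_mul, Complex.norm_real, Complex.norm_real, Real.norm_eq_abs, Real.norm_eq_abs]
    gcongr
    exact hC s hs
  have h3 : ‖d t‖ = ‖oscShift a ψ Z₀ ν t‖ := by
    rw [hd]
    simp only
    rw [norm_mul, norm_exp_neg_I_mul, one_mul]
  have h4 : ‖d 0‖ = ‖oscShift a ψ Z₀ ν 0‖ := by simp [hd]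
  rw [← h3, ← h4]
  have h5 : ‖t - 0‖ ≤ R := by
    rw [sub_zero, Real.norm_eq_abs, abs_le]; exact ⟨ht.1, ht.2⟩
  calc ‖d t‖ ≤ ‖d 0‖ + ‖d t - d 0‖ := by
        have := norm_add_le (d 0) (d t - d 0)
        rwa [add_sub_cancel] at this
    _ ≤ ‖d 0‖ + (|a ν / ν| * C) * R := by
        gcongr
        exact h2.trans (by gcongr)
    _ = _ := by ring

theorem exists_abs_deriv_le {ψ : ℝ → ℝ} (hψ : ContDiff ℝ 1 ψ) (R : ℝ) :
    ∃ C, 0 ≤ C ∧ ∀ s ∈ Set.Icc (-R) R, |deriv ψ s| ≤ C := by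
  obtain ⟨C, hC⟩ := isCompact_Icc.exists_bound_of_continuousOn (s := Set.Icc (-R) R)
    (hψ.continuous_deriv le_rfl).continuousOn
  exact ⟨max C 0, le_max_right _ _, fun s hs => (hC s hs).trans (le_max_left _ _)⟩

theorem ae_ne_zero : ∀ᵐ ν : ℝ, ν ≠ 0 := by
  simp [ae_iff, measure_singleton]

theorem memLp_oscShift_zero {a ψ : ℝ → ℝ} (hb : MemLp (fun ν => a ν / ν) 2) {Z₀ : ℝ → ℂ}
    (hZ : MemLp Z₀ 2) : MemLp (fun ν => oscShift a ψ Z₀ ν 0) 2 := by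
  have h1 : MemLp (fun ν => ((a ν / ν : ℝ) : ℂ)) 2 := hb.ofReal
  refine (hZ.sub (h1.const_mul (Complex.I * ψ 0))).ae_eq (Eventually.of_forall fun ν => ?_)
  simp [oscShift, oscAmp]
  ring

theorem memLp_oscShift {a ψ : ℝ → ℝ} (hψ : ContDiff ℝ 1 ψ) (ha : Continuous a)
    (hb : MemLp (fun ν => a ν / ν) 2) {Z₀ : ℝ → ℂ} (hZ : MemLp Z₀ 2) (t : ℝ) :
    MemLp (fun ν => oscShift a ψ Z₀ ν t) 2 := by
  obtain ⟨C, hC0, hC⟩ := exists_abs_deriv_le hψ |t|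
  have h1 : MemLp (fun ν => ((a ν / ν : ℝ) : ℂ)) 2 := hb.ofReal
  refine MemLp.of_le ((memLp_oscShift_zero (ψ := ψ) hb hZ).norm.add (hb.abs.const_mul (C * |t|)))
    ((aestronglyMeasurable_oscAmp hψ.continuous ha hZ.1 t).sub
      ((h1.1.const_mul _).mul_const _)) ?_
  filter_upwards [ae_ne_zero] with ν hν
  refine (norm_oscShift_le hψ Z₀ hν (abs_nonneg t) hC ⟨neg_abs_le t, le_abs_self t⟩).trans ?_
  simp only [Pi.add_apply]
  exact le_abs_self _

theorem oscAmp_eq (a ψ : ℝ → ℝ) (Z₀ : ℝ → ℂ) (ν t : ℝ) : oscAmp a ψ Z₀ ν t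
    = oscShift a ψ Z₀ ν t + Complex.I * ψ t * ((a ν / ν : ℝ) : ℂ) := by
  unfold oscShift
  ring

theorem memLp_oscAmp {a ψ : ℝ → ℝ} (hψ : ContDiff ℝ 1 ψ) (ha : Continuous a)
    (hb : MemLp (fun ν => a ν / ν) 2) {Z₀ : ℝ → ℂ} (hZ : MemLp Z₀ 2) (t : ℝ) :
    MemLp (fun ν => oscAmp a ψ Z₀ ν t) 2 := by
  simp_rw [oscAmp_eq]
  exact (memLp_oscShift hψ ha hb hZ t).add (hb.ofReal.const_mul _)

theorem integrable_mul_im_oscAmp {a ψ : ℝ → ℝ} (hψ : ContDiff ℝ 1 ψ) (ha : Continuous a)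
    (hb : MemLp (fun ν => a ν / ν) 2) {Z₀ : ℝ → ℂ} (hZ : MemLp Z₀ 2) (t : ℝ) :
    Integrable fun ν => a ν / ν * (oscAmp a ψ Z₀ ν t).im :=
  hb.integrable_mul (memLp_oscAmp hψ ha hb hZ t).im

/-- The energy of the oscillators relative to the moving equilibria, and the work done on them. -/
theorem hasDerivAt_oscEnergy {a ψ : ℝ → ℝ} (hψ : ContDiff ℝ 1 ψ) (ha : Continuous a)
    (hb : MemLp (fun ν => a ν / ν) 2) {Z₀ : ℝ → ℂ} (hZ : MemLp Z₀ 2) (t : ℝ) :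
    HasDerivAt (fun t => ∫ ν, ‖oscShift a ψ Z₀ ν t‖ ^ 2 / 2)
      (-(deriv ψ t * ((∫ ν, a ν / ν * (oscAmp a ψ Z₀ ν t).im) - (∫ ν, (a ν / ν) ^ 2) * ψ t))) t := by
  set R := |t| + 1 with hR
  obtain ⟨C, hC0, hC⟩ := exists_abs_deriv_le hψ R
  have hR0 : 0 ≤ R := by positivity
  have hm := fun s => memLp_oscShift hψ ha hb hZ s
  have hsq := fun s => (memLp_two_iff_integrable_sq_norm (hm s).1).1 (hm s)
  have hbound : Integrable fun ν => C * (|a ν / ν|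
      * (‖oscShift a ψ Z₀ ν 0‖ + C * R * |a ν / ν|)) :=
    (hb.abs.integrable_mul ((hm 0).norm.add (hb.abs.const_mul (C * R)))).const_mul C
  have hs : Set.Icc (-R) R ∈ 𝓝 t := Icc_mem_nhds (by rw [hR]; linarith [neg_abs_le t])
    (by rw [hR]; linarith [le_abs_self t])
  have h := (hasDerivAt_integral_of_dominated_loc_of_deriv_le (μ := volume)
    (F := fun t ν => ‖oscShift a ψ Z₀ ν t‖ ^ 2 / 2)
    (F' := fun t ν => -(deriv ψ t * (a ν / ν * (oscShift a ψ Z₀ ν t).im))) hs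
    (Eventually.of_forall fun s => ((hsq s).div_const 2).aestronglyMeasurable)
    ((hsq t).div_const 2)
    (((hb.1.mul (hm t).im.1).const_mul _).neg)
    (bound := fun ν => C * (|a ν / ν| * (‖oscShift a ψ Z₀ ν 0‖ + C * R * |a ν / ν|))) ?_ hbound
    ?_).2
  · refine h.congr_deriv ?_
    rw [integral_neg, integral_const_mul, ← integral_mul_const, ← integral_sub]
    · congr 2
      refine integral_congr_ae (Eventually.of_forall fun ν => ?_)
      simp only [oscAmp_eq]
      simp
      ring
    · exact integrable_mul_im_oscAmp hψ ha hb hZ t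
    · exact hb.integrable_sq.mul_const _
  · filter_upwards [ae_ne_zero] with ν hν s hs
    rw [norm_neg, norm_mul, norm_mul, Real.norm_eq_abs, Real.norm_eq_abs, Real.norm_eq_abs]
    gcongr
    · exact hC s hs
    · exact (Complex.abs_im_le_norm _).trans (norm_oscShift_le hψ Z₀ hν hR0 hC hs)
  · filter_upwards [ae_ne_zero] with ν hν s _
    exact hasDerivAt_half_norm_sq_oscShift hψ Z₀ hν s

theorem eLpNorm_two_le_of_integral_sq_le {f : ℝ → ℂ} (hf : MemLp f 2) {C : ℝ}
    (hC : ∫ ν, ‖f ν‖ ^ 2 ≤ C) : eLpNorm f 2 volume ≤ ENNReal.ofReal (√C) := by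
  rw [hf.eLpNorm_eq_integral_rpow_norm (by norm_num) (by norm_num), Real.sqrt_eq_rpow]
  simp only [ENNReal.toReal_ofNat, Real.rpow_ofNat]
  norm_num only
  exact ENNReal.ofReal_le_ofReal (Real.rpow_le_rpow
    (integral_nonneg fun _ => by positivity) hC (by norm_num))

/-- If the oscillator energy and the force are bounded uniformly in time, then the functions
`a F(ψ 1_{(-n, n]})` are bounded in `L²`: they are combinations of the amplitudes at the times
`n` and `-n`. -/
theorem exists_eLpNorm_window_le {a ψ : ℝ → ℝ} (hψ : ContDiff ℝ 1 ψ) (ha : Continuous a)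
    (hb : MemLp (fun ν => a ν / ν) 2) {Z₀ : ℝ → ℂ} (hZ : MemLp Z₀ 2) {Cψ CJ : ℝ}
    (hCψ : ∀ t, |ψ t| ≤ Cψ) (hCJ : ∀ t, ∫ ν, ‖oscShift a ψ Z₀ ν t‖ ^ 2 / 2 ≤ CJ) :
    ∃ C : NNReal, ∀ n : ℕ,
      eLpNorm (fun ν => (a ν : ℂ) * fourierFun (window (fun t => (ψ t : ℂ)) n) ν) 2 volume ≤ C := by
  have hbC : MemLp (fun ν => ((a ν / ν : ℝ) : ℂ)) 2 := hb.ofReal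
  set B : ENNReal := ENNReal.ofReal (√(2 * CJ))
    + ENNReal.ofReal Cψ * eLpNorm (fun ν => ((a ν / ν : ℝ) : ℂ)) 2 volume with hB
  have hBtop : B ≠ ⊤ := ENNReal.add_ne_top.2 ⟨ENNReal.ofReal_ne_top,
    ENNReal.mul_ne_top ENNReal.ofReal_ne_top hbC.2.ne⟩
  have hamp : ∀ t, eLpNorm (fun ν => oscAmp a ψ Z₀ ν t) 2 volume ≤ B := by
    intro t
    have hY := memLp_oscShift hψ ha hb hZ t
    simp_rw [oscAmp_eq]
    refine (eLpNorm_add_le hY.1 (hbC.1.const_mul _) (by norm_num)).trans ?_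
    refine add_le_add ?_ ?_
    · refine eLpNorm_two_le_of_integral_sq_le hY ?_
      have := hCJ t
      rw [integral_div] at this
      linarith
    · refine (eLpNorm_le_mul_eLpNorm_of_ae_le_mul (c := Cψ) (Eventually.of_forall fun ν => ?_) 2)
      rw [norm_mul, norm_mul, Complex.norm_I, one_mul, Complex.norm_real, Real.norm_eq_abs]
      gcongr
      exact hCψ t
  refine ⟨(B + B).toNNReal, fun n => ?_⟩
  rw [ENNReal.coe_toNNReal (by simp [hBtop])]
  have hexp : ∀ (ν t : ℝ), Complex.exp (-Complex.I * ν * t) * oscAmp a ψ Z₀ ν t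
      = Z₀ ν + a ν * ∫ s in (0 : ℝ)..t, Complex.exp (-Complex.I * ν * s) * ψ s := by
    intro ν t
    rw [oscAmp, ← mul_assoc, exp_neg_mul_exp, one_mul]
  have hid : (fun ν => (a ν : ℂ) * fourierFun (window (fun t => (ψ t : ℂ)) n) ν)
      = (fun ν : ℝ => Complex.exp (-Complex.I * ν * (n : ℝ)) * oscAmp a ψ Z₀ ν n)
        - fun ν : ℝ => Complex.exp (-Complex.I * ν * ((-n : ℝ) : ℝ)) * oscAmp a ψ Z₀ ν (-n) := by
    ext ν
    have hc : Continuous fun s : ℝ => Complex.exp (-Complex.I * ν * s) * (ψ s : ℂ) := by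
      have := hψ.continuous
      fun_prop
    rw [Pi.sub_apply, hexp, hexp, fourierFun_window,
      ← intervalIntegral.integral_interval_sub_left (hc.intervalIntegrable 0 n)
        (hc.intervalIntegrable 0 (-n))]
    ring
  have hmem := fun t => (memLp_oscAmp hψ ha hb hZ t).1
  rw [hid]
  refine (eLpNorm_sub_le ?_ ?_ (by norm_num)).trans ?_
  · exact (Continuous.aestronglyMeasurable (by fun_prop)).mul (hmem _)
  · exact (Continuous.aestronglyMeasurable (by fun_prop)).mul (hmem _)
  · gcongr
    · refine (le_of_eq ?_).trans (hamp n)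
      refine eLpNorm_congr_norm_ae (Eventually.of_forall fun ν => ?_)
      rw [norm_mul, norm_exp_neg_I_mul, one_mul]
    · refine (le_of_eq ?_).trans (hamp (-n))
      refine eLpNorm_congr_norm_ae (Eventually.of_forall fun ν => ?_)
      rw [norm_mul, norm_exp_neg_I_mul, one_mul]

/-! ### The kernel `w` -/

theorem wHat_eq (a : ℝ → ℝ) (ν : ℝ) :
    wHat a ν = 2 * Real.pi / Complex.I * ((a ν ^ 2 / ν : ℝ) : ℂ) := by
  unfold wHat
  push_cast
  ring

theorem abs_div_le_of_deriv {a : ℝ → ℝ} (ha : Differentiable ℝ a) (ha0 : a 0 = 0) {C : ℝ}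
    (hC : ∀ ν, |deriv a ν| ≤ C) (ν : ℝ) : |a ν / ν| ≤ C := by
  have hC0 : 0 ≤ C := (abs_nonneg _).trans (hC 0)
  by_cases hν : ν = 0
  · simpa [hν] using hC0
  have h := convex_univ.norm_image_sub_le_of_norm_deriv_le (f := a) (x := 0) (y := ν)
    (fun x _ => ha x) (fun x _ => hC x) (Set.mem_univ _) (Set.mem_univ _)
  rw [ha0, sub_zero, sub_zero, Real.norm_eq_abs, Real.norm_eq_abs] at h
  rw [abs_div, div_le_iff₀ (abs_pos.2 hν)]
  exact h

/-- Since `a` and `a / ν` are square integrable, `a / ν` is integrable. -/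
theorem integrable_div {a : ℝ → ℝ} (ha2 : MemLp a 2) (hb : MemLp (fun ν => a ν / ν) 2) :
    Integrable fun ν => a ν / ν := by
  refine ((hb.integrable_sq.add ha2.integrable_sq).add integrable_inv_one_add_sq).mono' hb.1 ?_
  filter_upwards [ae_ne_zero] with ν hν
  simp only [Pi.add_apply, Real.norm_eq_abs]
  set x := |a ν / ν| with hx
  have hx0 : 0 ≤ x := abs_nonneg _
  have h1 : (a ν / ν) ^ 2 = x ^ 2 := (sq_abs _).symm
  have h2 : a ν ^ 2 = ν ^ 2 * x ^ 2 := by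
    rw [← h1]
    field_simp
  rw [h1, h2]
  exact le_sq_add_inv_one_add_sq hx0 ν

theorem hasDerivAt_sq_div {a : ℝ → ℝ} (ha : Differentiable ℝ a) {ν : ℝ} (hν : ν ≠ 0) :
    HasDerivAt (fun ν => a ν ^ 2 / ν) (2 * (a ν / ν * deriv a ν) - (a ν / ν) ^ 2) ν := by
  refine (((ha ν).hasDerivAt.pow 2).div (hasDerivAt_id ν) hν).congr_deriv ?_
  simp only [id]
  field_simp
  simp
  ring

theorem differentiable_sq_div {a : ℝ → ℝ} (ha : Differentiable ℝ a) (ha0 : a 0 = 0) :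
    Differentiable ℝ fun ν => a ν ^ 2 / ν := by
  intro ν
  by_cases hν : ν = 0
  · subst hν
    have h1 : Tendsto (fun t => t⁻¹ • (a (0 + t) - a 0)) (𝓝[≠] 0) (𝓝 (deriv a 0)) :=
      hasDerivAt_iff_tendsto_slope_zero.1 (ha 0).hasDerivAt
    refine HasDerivAt.differentiableAt (f' := deriv a 0 ^ 2)
      (hasDerivAt_iff_tendsto_slope_zero.2 ((h1.pow 2).congr fun t => ?_))
    simp only [zero_add, ha0, sub_zero, smul_eq_mul, div_zero]
    ring
  · exact (hasDerivAt_sq_div ha hν).differentiableAt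

theorem integrable_sq_div {a : ℝ → ℝ} (ha2 : MemLp a 2) (hb : MemLp (fun ν => a ν / ν) 2) :
    Integrable fun ν => a ν ^ 2 / ν :=
  (ha2.integrable_mul hb).congr (Eventually.of_forall fun ν => by simp only [Pi.mul_apply]; ring)

theorem integrable_wHat {a : ℝ → ℝ} (ha2 : MemLp a 2) (hb : MemLp (fun ν => a ν / ν) 2) :
    Integrable (wHat a) := by
  rw [funext (wHat_eq a)]
  exact (integrable_sq_div ha2 hb).ofReal.const_mul _

/-- The function `ŵ` lies in Wiener's algebra, since `ŵ` and its derivative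
`(2π / i) (2 a a' / ν - a² / ν²)` lie in `L¹ ∩ L²`. -/
theorem inWiener_wHat {a : ℝ → ℝ} (ha : Differentiable ℝ a) (ha0 : a 0 = 0) (ha2 : MemLp a 2)
    (hb : MemLp (fun ν => a ν / ν) 2) {C : ℝ} (hC : ∀ ν, |deriv a ν| ≤ C) : InWiener (wHat a) := by
  have hd : Differentiable ℝ (wHat a) := by
    rw [funext (wHat_eq a)]
    exact fun ν => ((differentiable_sq_div ha ha0 ν).hasDerivAt.ofReal_comp.const_mul
      _).differentiableAt
  have hbb := abs_div_le_of_deriv ha ha0 hC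
  have hb1 := integrable_div ha2 hb
  have hm : AEStronglyMeasurable (deriv a) volume := (measurable_deriv a).aestronglyMeasurable
  have hderiv : (fun ν => 2 * Real.pi / Complex.I
      * (((2 * (a ν / ν * deriv a ν) - (a ν / ν) ^ 2 : ℝ)) : ℂ)) =ᵐ[volume] deriv (wHat a) := by
    filter_upwards [ae_ne_zero] with ν hν
    have h := ((hasDerivAt_sq_div ha hν).ofReal_comp).const_mul (2 * Real.pi / Complex.I)
    rw [← funext (wHat_eq a)] at h
    exact h.deriv.symm
  have hsq2 : MemLp (fun ν => a ν ^ 2 / ν) 2 := by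
    refine (ha2.of_le_mul (c := C)
      (integrable_sq_div ha2 hb).aestronglyMeasurable (Eventually.of_forall fun ν => ?_))
    rw [show a ν ^ 2 / ν = a ν / ν * a ν by ring, norm_mul]
    gcongr
    exact hbb ν
  have hreal1 : Integrable fun ν => 2 * (a ν / ν * deriv a ν) - (a ν / ν) ^ 2 :=
    ((hb1.mul_bdd (c := C) hm (Eventually.of_forall hC)).const_mul 2).sub hb.integrable_sq
  have hreal2 : MemLp (fun ν => 2 * (a ν / ν * deriv a ν) - (a ν / ν) ^ 2) 2 := by
    refine MemLp.of_le_mul (c := 3 * C) hb hreal1.aestronglyMeasurable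
      (Eventually.of_forall fun ν => ?_)
    rw [show 2 * (a ν / ν * deriv a ν) - (a ν / ν) ^ 2
      = (2 * deriv a ν - a ν / ν) * (a ν / ν) by ring, norm_mul]
    gcongr
    refine (norm_sub_le _ _).trans ?_
    rw [norm_mul, Real.norm_ofNat, Real.norm_eq_abs, Real.norm_eq_abs]
    linarith [hC ν, hbb ν]
  refine ⟨hd.continuous, integrable_wHat ha2 hb, ?_⟩
  refine integrable_fourierFun_of_deriv hd (integrable_wHat ha2 hb) ?_ ?_ ?_
  · rw [funext (wHat_eq a)]
    exact hsq2.ofReal.const_mul _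
  · exact (hreal1.ofReal.const_mul _).congr hderiv
  · exact (hreal2.ofReal.const_mul _).ae_eq hderiv

/-- The response function `τ ↦ ∫ exp(i ν τ) a(ν)² / ν dν`, with imaginary part
`(w(τ) - w(-τ)) / 2`. -/
def response (a : ℝ → ℝ) (τ : ℝ) : ℂ :=
  ∫ ν : ℝ, Complex.exp (Complex.I * ν * τ) * ((a ν ^ 2 / ν : ℝ) : ℂ)

theorem wKer_eq (a : ℝ → ℝ) (τ : ℝ) : wKer a τ = -Complex.I * response a τ := by
  have hpi : (Real.pi : ℂ) ≠ 0 := by exact_mod_cast Real.pi_ne_zero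
  rw [wKer, fourierInvFun, response, ← integral_const_mul, ← integral_const_mul]
  refine integral_congr_ae (Eventually.of_forall fun ν => ?_)
  simp only [wHat_eq]
  rw [div_eq_mul_inv (2 * Real.pi : ℂ), Complex.inv_I]
  generalize ((a ν ^ 2 / ν : ℝ) : ℂ) = g
  field_simp

theorem response_neg (a : ℝ → ℝ) (τ : ℝ) :
    response a (-τ) = (starRingEnd ℂ) (response a τ) := by
  rw [response, response, ← integral_conj]
  refine integral_congr_ae (Eventually.of_forall fun ν => ?_)
  simp only [map_mul, ← Complex.exp_conj, Complex.conj_I, Complex.conj_ofReal]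
  push_cast
  ring_nf

theorem wKer_sub_wKer_neg (a : ℝ → ℝ) (τ : ℝ) :
    (wKer a τ - wKer a (-τ)) / 2 = (((response a τ).im : ℝ) : ℂ) := by
  rw [wKer_eq, wKer_eq, response_neg]
  apply Complex.ext <;> simp

theorem continuous_response {a : ℝ → ℝ} (hi : Integrable fun ν => a ν ^ 2 / ν) :
    Continuous (response a) := by
  refine continuous_of_dominated (bound := fun ν => ‖((a ν ^ 2 / ν : ℝ) : ℂ)‖) (fun τ => ?_)
    (fun τ => Eventually.of_forall fun ν => ?_) hi.ofReal.norm
    (Eventually.of_forall fun ν => by fun_prop)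
  · exact (Continuous.aestronglyMeasurable (by fun_prop)).mul hi.ofReal.aestronglyMeasurable
  · rw [norm_mul, norm_exp_I_mul, one_mul]

theorem norm_response_le (a : ℝ → ℝ) (τ : ℝ) :
    ‖response a τ‖ ≤ ∫ ν, ‖((a ν ^ 2 / ν : ℝ) : ℂ)‖ := by
  refine (norm_integral_le_integral_norm _).trans (le_of_eq ?_)
  simp only [norm_mul, norm_exp_I_mul, one_mul]

/-! ### Retarded convolutions -/

section Retarded

variable {k ψ : ℝ → ℂ}

/-- The retarded convolution `t ↦ ∫₀ᵗ k(τ) ψ(t - τ) dτ`, with an oriented integral for `t < 0`. -/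
def retarded (k ψ : ℝ → ℂ) (t : ℝ) : ℂ := ∫ τ in (0 : ℝ)..t, k τ * ψ (t - τ)

theorem retarded_mem_Cb (hk : Integrable k) {B : ℝ} (hB : ∀ τ, ‖k τ‖ ≤ B) (hψ : ψ ∈ Cb)
    {L : ℝ} (hL : ∀ s t, ‖ψ s - ψ t‖ ≤ L * |s - t|) : retarded k ψ ∈ Cb := by
  obtain ⟨huc, C, hC⟩ := hψ
  have hB0 : 0 ≤ B := (norm_nonneg _).trans (hB 0)
  have hC0 : 0 ≤ C := (norm_nonneg _).trans (hC 0)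
  have hL0 : 0 ≤ L := by
    have := (norm_nonneg _).trans (hL 1 0)
    simpa using this
  have hint : ∀ t, Integrable fun τ => k τ * ψ (t - τ) := fun t =>
    hk.mul_bdd (c := C) (huc.continuous.comp (by fun_prop)).aestronglyMeasurable
      (Eventually.of_forall fun τ => hC _)
  set I := ∫ τ, ‖k τ‖ with hI
  have hI0 : 0 ≤ I := integral_nonneg fun _ => norm_nonneg _
  refine ⟨?_, I * C, fun t => ?_⟩
  · refine (LipschitzWith.of_dist_le_mul (K := (I * L + B * C).toNNReal)
      fun t s => ?_).uniformContinuous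
    rw [Real.coe_toNNReal _ (by positivity), dist_eq_norm, Real.dist_eq]
    have h1 : retarded k ψ t - retarded k ψ s
        = (∫ τ in (0 : ℝ)..s, k τ * (ψ (t - τ) - ψ (s - τ)))
          + ∫ τ in s..t, k τ * ψ (t - τ) := by
      have h2 := intervalIntegral.integral_add_adjacent_intervals
        ((hint t).intervalIntegrable (a := 0) (b := s)) ((hint t).intervalIntegrable (b := t))
      simp only [mul_sub]
      rw [intervalIntegral.integral_sub (hint t).intervalIntegrable (hint s).intervalIntegrable,
        retarded, retarded, ← h2]
      ring
    rw [h1, add_mul]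
    refine (norm_add_le _ _).trans (add_le_add ?_ ?_)
    · refine intervalIntegral.norm_integral_le_integral_norm_uIoc.trans ?_
      have h3 : Integrable fun τ => k τ * (ψ (t - τ) - ψ (s - τ)) := by
        simp only [mul_sub]
        exact (hint t).sub (hint s)
      refine (setIntegral_le_integral h3.norm (Eventually.of_forall fun _ => norm_nonneg _)).trans ?_
      calc ∫ τ, ‖k τ * (ψ (t - τ) - ψ (s - τ))‖
          ≤ ∫ τ, ‖k τ‖ * (L * |t - s|) := by
            refine integral_mono h3.norm (hk.norm.mul_const _) fun τ => ?_
            simp only [norm_mul]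
            gcongr
            have := hL (t - τ) (s - τ)
            rwa [sub_sub_sub_cancel_right] at this
        _ = I * L * |t - s| := by rw [integral_mul_const, mul_assoc]
    · refine intervalIntegral.norm_integral_le_of_norm_le_const fun τ _ => ?_
      rw [norm_mul]
      gcongr
      exacts [hB τ, hC _]
  · refine intervalIntegral.norm_integral_le_integral_norm_uIoc.trans ?_
    refine (setIntegral_le_integral (hint t).norm
      (Eventually.of_forall fun _ => norm_nonneg _)).trans ?_
    rw [hI, ← integral_mul_const]
    refine integral_mono (hint t).norm (hk.norm.mul_const _) fun τ => ?_
    simp only [norm_mul]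
    gcongr
    exact hC _

/-- Convolutions with the restrictions of `k` to sets `T t` that converge pointwise to `S` are
asymptotic to the convolution with the restriction of `k` to `S`. -/
theorem tendsto_integral_window_sub {l : Filter ℝ} [l.IsCountablyGenerated] (hk : Integrable k)
    (hψ : ψ ∈ Cb) {S : Set ℝ} (hS : MeasurableSet S) {T : ℝ → Set ℝ}
    (hT : ∀ t, MeasurableSet (T t)) (hlim : ∀ τ, ∀ᶠ t in l, (τ ∈ T t ↔ τ ∈ S)) :
    Tendsto (fun t => (∫ τ, (T t).indicator k τ * ψ (t - τ)) - ∫ τ, S.indicator k τ * ψ (t - τ)) l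
      (𝓝 0) := by
  obtain ⟨huc, C, hC⟩ := hψ
  have hm : ∀ t, AEStronglyMeasurable (fun τ => ψ (t - τ)) volume := fun t =>
    (huc.continuous.comp (by fun_prop)).aestronglyMeasurable
  have hint : ∀ t, ∀ U : Set ℝ, MeasurableSet U →
      Integrable fun τ => U.indicator k τ * ψ (t - τ) := fun t U hU =>
    (hk.indicator hU).mul_bdd (c := C) (hm t) (Eventually.of_forall fun τ => hC _)
  have h1 : ∀ t, (∫ τ, (T t).indicator k τ * ψ (t - τ)) - ∫ τ, S.indicator k τ * ψ (t - τ)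
      = ∫ τ, ((T t).indicator k τ - S.indicator k τ) * ψ (t - τ) := fun t => by
    rw [← integral_sub (hint t _ (hT t)) (hint t _ hS)]
    exact integral_congr_ae (Eventually.of_forall fun τ => by simp only; ring)
  simp_rw [h1]
  rw [← integral_zero ℝ ℂ (μ := volume)]
  refine tendsto_integral_filter_of_dominated_convergence (fun τ => (‖k τ‖ + ‖k τ‖) * C)
    (Eventually.of_forall fun t => ((hk.indicator (hT t)).sub (hk.indicator hS)).1.mul (hm t))
    (Eventually.of_forall fun t => Eventually.of_forall fun τ => ?_)
    ((hk.norm.add hk.norm).mul_const C) (Eventually.of_forall fun τ => ?_)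
  · rw [norm_mul]
    gcongr
    · exact (norm_sub_le _ _).trans (add_le_add (norm_indicator_le_norm_self _ _)
        (norm_indicator_le_norm_self _ _))
    · exact hC _
  · refine tendsto_const_nhds.congr' ?_
    filter_upwards [hlim τ] with t ht
    have : (T t).indicator k τ = S.indicator k τ := by
      classical
      simp only [Set.indicator_apply, ht]
    rw [this, sub_self, zero_mul]

theorem conv_densityMeasure {u : ℝ → ℂ} (hu : Integrable u) (hψ : ψ ∈ Cb) (t : ℝ) :
    conv (densityMeasure u) ψ t = ∫ τ, u τ * ψ (t - τ) :=
  (hasDensity_densityMeasure hu).conv_eq hψ t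

theorem tendsto_retarded_sub_conv_atTop (hk : Integrable k) (hψ : ψ ∈ Cb) :
    Tendsto (fun t => retarded k ψ t - conv (densityMeasure ((Set.Ioi 0).indicator k)) ψ t) atTop
      (𝓝 0) := by
  refine (tendsto_integral_window_sub hk hψ (S := Set.Ioi 0) measurableSet_Ioi
    (T := fun t => Set.Ioc 0 t) (fun t => measurableSet_Ioc) fun τ => ?_).congr' ?_
  · filter_upwards [eventually_ge_atTop τ] with t ht
    exact ⟨fun h => h.1, fun h => ⟨h, ht⟩⟩
  · filter_upwards [eventually_ge_atTop 0] with t ht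
    rw [conv_densityMeasure (hk.indicator measurableSet_Ioi) hψ, retarded,
      intervalIntegral.integral_of_le ht, ← integral_indicator measurableSet_Ioc]
    congr 2
    ext τ
    rw [Set.indicator_mul_left]

theorem tendsto_retarded_sub_conv_atBot (hk : Integrable k) (hψ : ψ ∈ Cb) :
    Tendsto (fun t => retarded k ψ t
      - conv (densityMeasure ((Set.Iio 0).indicator fun τ => -k τ)) ψ t) atBot (𝓝 0) := by
  refine (tendsto_integral_window_sub (k := fun τ => -k τ) hk.neg hψ (S := Set.Iio 0)
    measurableSet_Iio (T := fun t => Set.Ioo t 0) (fun t => measurableSet_Ioo) fun τ => ?_).congr' ?_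
  · filter_upwards [eventually_lt_atBot τ] with t ht
    exact ⟨fun h => h.2, fun h => ⟨ht, h⟩⟩
  · filter_upwards [eventually_le_atBot 0] with t ht
    have hk' : Integrable ((Set.Iio (0 : ℝ)).indicator fun τ => -k τ) :=
      hk.neg.indicator measurableSet_Iio
    rw [conv_densityMeasure hk' hψ, retarded, intervalIntegral.integral_of_ge ht,
      ← integral_neg, integral_Ioc_eq_integral_Ioo, ← integral_indicator measurableSet_Ioo]
    congr 2
    ext τ
    simp only [Set.indicator_apply]
    split_ifs <;> ring

end Retarded

/-! ### The thermostat force -/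

/-- The thermostat force `∫ κ ξ dν` is the sum of a term that depends on the initial data and of the
retarded convolution of `ψ` with `(w(τ) - w(-τ)) / 2`. -/
theorem integral_mul_im_oscAmp {a ψ : ℝ → ℝ} (hψ : ContDiff ℝ 1 ψ) (ha2 : MemLp a 2)
    (hb : MemLp (fun ν => a ν / ν) 2) {Z₀ : ℝ → ℂ} (hZ : MemLp Z₀ 2) (t : ℝ) :
    ((∫ ν, a ν / ν * (oscAmp a ψ Z₀ ν t).im : ℝ) : ℂ)
      = (((fourierFun (fun ν => ((a ν / ν : ℝ) : ℂ) * Z₀ ν) (-t)).im : ℝ) : ℂ)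
        + retarded (fun τ => (((response a τ).im : ℝ) : ℂ)) (fun t => (ψ t : ℂ)) t := by
  have hψc := hψ.continuous
  have hbC : MemLp (fun ν => ((a ν / ν : ℝ) : ℂ)) 2 := hb.ofReal
  have hi := integrable_sq_div ha2 hb
  have hiC : Integrable fun ν => ((a ν ^ 2 / ν : ℝ) : ℂ) := hi.ofReal
  have h0 : Integrable fun ν => ((a ν / ν : ℝ) : ℂ) * Z₀ ν := hbC.integrable_mul hZ
  have hprod : Integrable (Function.uncurry fun (s ν : ℝ) =>
      Complex.exp (Complex.I * ν * (t - s)) * (((a ν ^ 2 / ν : ℝ) : ℂ) * ψ s))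
      ((volume.restrict (Set.uIoc 0 t)).prod volume) := by
    have hψi : Integrable (fun s => (ψ s : ℂ)) (volume.restrict (Set.uIoc 0 t)) :=
      ((Complex.continuous_ofReal.comp hψc).integrableOn_uIcc).mono_set Set.uIoc_subset_uIcc
    refine ((hψi.mul_prod hiC).bdd_mul (c := 1)
      (f := fun p : ℝ × ℝ => Complex.exp (Complex.I * p.2 * (t - p.1)))
      (Continuous.aestronglyMeasurable (by fun_prop))
      (Eventually.of_forall fun p => ?_)).congr (Eventually.of_forall fun p => ?_)
    · have := norm_exp_I_mul p.2 (t - p.1)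
      push_cast at this
      exact this.le
    · simp only [Function.uncurry]
      ring
  have hswap := intervalIntegral_integral_swap hprod
  have hinner : ∀ s : ℝ, ∫ ν : ℝ, Complex.exp (Complex.I * ν * (t - s))
      * (((a ν ^ 2 / ν : ℝ) : ℂ) * ψ s) = response a (t - s) * ψ s := fun s => by
    rw [response, ← integral_mul_const]
    refine integral_congr_ae (Eventually.of_forall fun ν => ?_)
    push_cast
    ring
  have houter : ∀ ν : ℝ, ∫ s in (0 : ℝ)..t, Complex.exp (Complex.I * ν * (t - s))
      * (((a ν ^ 2 / ν : ℝ) : ℂ) * ψ s) = ((a ν / ν : ℝ) : ℂ) * (Complex.exp (Complex.I * ν * t)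
        * (a ν * ∫ s in (0 : ℝ)..t, Complex.exp (-Complex.I * ν * s) * ψ s)) := fun ν => by
    rw [← intervalIntegral.integral_const_mul, ← intervalIntegral.integral_const_mul,
      ← intervalIntegral.integral_const_mul]
    refine intervalIntegral.integral_congr fun s _ => ?_
    rw [show Complex.I * ν * (t - s) = Complex.I * ν * t + -Complex.I * ν * s by ring,
      Complex.exp_add]
    push_cast
    ring
  simp_rw [hinner, houter] at hswap
  have h1 : Integrable fun ν : ℝ => ((a ν / ν : ℝ) : ℂ) * (Complex.exp (Complex.I * ν * t)
        * (a ν * ∫ s in (0 : ℝ)..t, Complex.exp (-Complex.I * ν * s) * ψ s)) := by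
    refine (hprod.integral_prod_right.smul (if 0 ≤ t then 1 else -1 : ℝ)).congr
      (Eventually.of_forall fun ν => ?_)
    beta_reduce
    rw [← houter, intervalIntegral.intervalIntegral_eq_integral_uIoc]
    rfl
  have h2 : Integrable fun ν : ℝ => Complex.exp (Complex.I * ν * t) * (((a ν / ν : ℝ) : ℂ) * Z₀ ν) :=
    h0.bdd_mul (c := 1) (by fun_prop) (Eventually.of_forall fun ν => (norm_exp_I_mul ν t).le)
  have h3 : ∫ ν, ((a ν / ν : ℝ) : ℂ) * oscAmp a ψ Z₀ ν t
      = fourierFun (fun ν => ((a ν / ν : ℝ) : ℂ) * Z₀ ν) (-t)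
        + ∫ s in (0 : ℝ)..t, response a (t - s) * ψ s := by
    rw [hswap, fourierFun]
    have h2' : Integrable fun ν : ℝ => Complex.exp (-Complex.I * ((-t : ℝ) : ℂ) * ν)
        * (((a ν / ν : ℝ) : ℂ) * Z₀ ν) := h0.exp_neg_I_mul _
    rw [← integral_add h2' h1]
    refine integral_congr_ae (Eventually.of_forall fun ν => ?_)
    simp only [oscAmp]
    rw [show -Complex.I * ((-t : ℝ) : ℂ) * ν = Complex.I * ν * t by push_cast; ring]
    ring
  have h4 : Integrable fun ν => ((a ν / ν : ℝ) : ℂ) * oscAmp a ψ Z₀ ν t := by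
    refine (h2.add h1).congr (Eventually.of_forall fun ν => ?_)
    simp only [Pi.add_apply, oscAmp]
    ring
  have h5 : ∫ ν, a ν / ν * (oscAmp a ψ Z₀ ν t).im
      = (∫ ν, ((a ν / ν : ℝ) : ℂ) * oscAmp a ψ Z₀ ν t).im := by
    have := integral_im h4
    simp only [RCLike.im_to_complex] at this
    rw [← this]
    refine integral_congr_ae (Eventually.of_forall fun ν => ?_)
    simp only [Complex.im_ofReal_mul]
  have hrc := continuous_response hi
  have h6 : retarded (fun τ => (((response a τ).im : ℝ) : ℂ)) (fun t => (ψ t : ℂ)) t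
      = (((∫ s in (0 : ℝ)..t, response a (t - s) * ψ s).im : ℝ) : ℂ) := by
    have h7 := intervalIntegral.integral_comp_sub_left (a := 0) (b := t)
      (fun s => (((response a s).im : ℝ) : ℂ) * ψ (t - s)) t
    simp only [sub_sub_cancel, sub_self, sub_zero] at h7
    rw [retarded, ← h7]
    have h8 := Complex.imCLM.intervalIntegral_comp_comm (a := 0) (b := t) (μ := volume)
      (f := fun s => response a (t - s) * ψ s)
      (Continuous.intervalIntegrable (by fun_prop) _ _)
    rw [Complex.imCLM_apply] at h8
    rw [← h8, ← intervalIntegral.integral_ofReal]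
    refine intervalIntegral.integral_congr fun s _ => ?_
    simp
  rw [h5, h3, h6, Complex.add_im, Complex.ofReal_add]

/-! ### The work of the force in a chart -/

section Coordinates

variable {E : Type*} [NormedAddCommGroup E] [NormedSpace ℝ E]

/-- The energy balance of a natural Lagrangian system in coordinates: if the Euler-Lagrange
equations hold with the generalized force `Φ dF`, then the energy changes at the rate
`Φ dF(q̇)`. -/
theorem hasDerivAt_energy_of_eulerLagrange {B : E → E →L[ℝ] E →L[ℝ] ℝ} {U F : E → ℝ} {q : ℝ → E}
    {t Φ : ℝ} (hsymm : ∀ y v w, B y v w = B y w v) (hB : DifferentiableAt ℝ B (q t))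
    (hU : DifferentiableAt ℝ U (q t)) (hq : DifferentiableAt ℝ q t)
    (hq' : DifferentiableAt ℝ (deriv q) t)
    (hEL : HasDerivAt (fun s => fderiv ℝ (fun v => B (q s) v v / 2 - U (q s)) (deriv q s))
      (fderiv ℝ (fun y => B y (deriv q t) (deriv q t) / 2 - U y) (q t) + Φ • fderiv ℝ F (q t)) t) :
    HasDerivAt (fun s => B (q s) (deriv q s) (deriv q s) / 2 + U (q s))
      (Φ * fderiv ℝ F (q t) (deriv q t)) t := by
  -- the momentum, written with the bilinear form `B`
  have hp : ∀ s, fderiv ℝ (fun v => B (q s) v v / 2 - U (q s)) (deriv q s)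
      = B (q s) (deriv q s) := fun s => by
    have h : HasFDerivAt (fun v => B (q s) v v) _ (deriv q s) :=
      (B (q s)).hasFDerivAt.clm_apply (hasFDerivAt_id (deriv q s))
    have h2 := (h.mul_const (2⁻¹ : ℝ)).sub_const (U (q s))
    simp only [← div_eq_mul_inv] at h2
    rw [h2.fderiv]
    ext w
    simp [hsymm (q s) w (deriv q s)]
    ring
  simp only [hp] at hEL
  have hBq : HasDerivAt (fun s => B (q s)) (fderiv ℝ B (q t) (deriv q t)) t :=
    HasFDerivAt.comp_hasDerivAt (l := B) (f := q) (l' := fderiv ℝ B (q t)) t hB.hasFDerivAt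
      hq.hasDerivAt
  have hp' := hBq.clm_apply hq'.hasDerivAt
  have heq := congrArg (fun P : E →L[ℝ] ℝ => P (deriv q t)) (hp'.unique hEL)
  have hT : HasFDerivAt (fun y => B y (deriv q t) (deriv q t) / 2 - U y)
      ((2⁻¹ : ℝ) • ((fderiv ℝ B (q t)).flip (deriv q t)).flip (deriv q t) - fderiv ℝ U (q t))
      (q t) := by
    have h1 := ((hB.hasFDerivAt.clm_apply (hasFDerivAt_const (deriv q t) (q t))).clm_apply
      (hasFDerivAt_const (deriv q t) (q t))).mul_const (2⁻¹ : ℝ)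
    simp only [← div_eq_mul_inv] at h1
    refine (h1.sub hU.hasFDerivAt).congr_fderiv ?_
    ext w
    simp
  rw [hT.fderiv] at heq
  have h3 := (hp'.clm_apply hq'.hasDerivAt).div_const 2
  have h4 : HasDerivAt (fun s => U (q s)) (fderiv ℝ U (q t) (deriv q t)) t :=
    hU.hasFDerivAt.comp_hasDerivAt t hq.hasDerivAt
  refine (h3.add h4).congr_deriv ?_
  simp only [add_apply, sub_apply, smul_apply, ContinuousLinearMap.flip_apply, smul_eq_mul] at heq ⊢
  rw [hsymm (q t) (deriv q t) (deriv (deriv q) t)]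
  linarith

/-- A continuous family of positive definite quadratic forms on a finite dimensional space is
bounded below locally uniformly. -/
theorem exists_pos_mul_sq_norm_le [FiniteDimensional ℝ E] {B : E → E →L[ℝ] E →L[ℝ] ℝ} {q₀ : E}
    (hB : ContinuousAt B q₀) (hpos : ∀ v, v ≠ 0 → 0 < B q₀ v v) :
    ∃ δ > 0, ∀ᶠ q in 𝓝 q₀, ∀ v, δ * ‖v‖ ^ 2 ≤ B q v v := by
  obtain ⟨δ, hδ, h⟩ : ∃ δ > 0, ∀ v, 2 * δ * ‖v‖ ^ 2 ≤ B q₀ v v := by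
    rcases (Metric.sphere (0 : E) 1).eq_empty_or_nonempty with he | hne
    · refine ⟨1, one_pos, fun v => ?_⟩
      by_cases hv : v = 0
      · simp [hv]
      · have h1 : (‖v‖⁻¹ • v) ∈ Metric.sphere (0 : E) 1 := by
          simp [norm_smul, hv]
        rw [he] at h1
        exact h1.elim
    · obtain ⟨u, hu, hmin⟩ := (isCompact_sphere (0 : E) 1).exists_isMinOn hne
        (f := fun v => B q₀ v v) (by fun_prop)
      have hu0 : u ≠ 0 := by
        rintro rfl
        simp at hu
      refine ⟨B q₀ u u / 2, half_pos (hpos u hu0), fun v => ?_⟩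
      by_cases hv : v = 0
      · simp [hv]
      · have h1 : (‖v‖⁻¹ • v) ∈ Metric.sphere (0 : E) 1 := by
          simp [norm_smul, hv]
        have h2 := isMinOn_iff.1 hmin _ h1
        simp only [map_smul, smul_apply, smul_eq_mul] at h2
        have hn : 0 < ‖v‖ := norm_pos_iff.2 hv
        calc 2 * (B q₀ u u / 2) * ‖v‖ ^ 2 = B q₀ u u * ‖v‖ ^ 2 := by ring
          _ ≤ ‖v‖⁻¹ * (‖v‖⁻¹ * B q₀ v v) * ‖v‖ ^ 2 := by gcongr
          _ = B q₀ v v := by field_simp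
  refine ⟨δ, hδ, ?_⟩
  have hev : ∀ᶠ q in 𝓝 q₀, B q ∈ Metric.ball (B q₀) δ := hB (Metric.ball_mem_nhds (B q₀) hδ)
  filter_upwards [hev] with q hq v
  have hle : ‖B q - B q₀‖ ≤ δ := ((dist_eq_norm (B q) (B q₀)).symm.trans_lt hq).le
  have h1 : |B q v v - B q₀ v v| ≤ δ * ‖v‖ ^ 2 := by
    have h2 := (B q - B q₀).le_opNorm₂ v v
    calc |B q v v - B q₀ v v| = ‖(B q - B q₀) v v‖ := rfl
      _ ≤ ‖B q - B q₀‖ * ‖v‖ * ‖v‖ := h2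
      _ ≤ δ * ‖v‖ * ‖v‖ := by
        gcongr
      _ = δ * ‖v‖ ^ 2 := by ring
  have := (abs_le.1 h1).1
  linarith [h v]

end Coordinates

/-! ### The kinetic energy -/

section Kinetic

variable {m : ℕ} {M : Type*} [TopologicalSpace M] [ChartedSpace (EuclideanSpace ℝ (Fin m)) M]
  [IsManifold 𝓘(ℝ, EuclideanSpace ℝ (Fin m)) ∞ M]

local notation "𝔼" => EuclideanSpace ℝ (Fin m)
local notation "𝕀" => 𝓘(ℝ, EuclideanSpace ℝ (Fin m))

/-- The bilinear form `(v, w) ↦ ⟨A(q) v, w⟩` in the chart `c`. -/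
def kineticBilin (A : RiemannMetric m M) (c : OpenPartialHomeomorph M 𝔼) (q : 𝔼) :
    𝔼 →L[ℝ] 𝔼 →L[ℝ] ℝ :=
  -- The tangent spaces are identified with the model space, so as to get a normed target.
  let B : 𝔼 →L[ℝ] 𝔼 →L[ℝ] ℝ := A.inner (c.symm q)
  let D : 𝔼 →L[ℝ] 𝔼 := mfderiv 𝕀 𝕀 c.symm q
  B.bilinearComp D D

theorem kineticBilin_symm (A : RiemannMetric m M) (c : OpenPartialHomeomorph M 𝔼) (q v w : 𝔼) :
    kineticBilin A c q v w = kineticBilin A c q w v :=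
  A.symm _ _ _

theorem kineticBilin_pos (A : RiemannMetric m M) {c : OpenPartialHomeomorph M 𝔼}
    (hc : c ∈ atlas 𝔼 M) {q : 𝔼} (hq : q ∈ c.target) {v : 𝔼} (hv : v ≠ 0) :
    0 < kineticBilin A c q v v := by
  have hinj := (mdifferentiable_of_mem_atlas (I := 𝕀) hc).symm.mfderiv_injective (x := q) hq
  exact A.pos _ _ fun h => hv (hinj (h.trans (map_zero _).symm))

theorem contMDiffOn_chart_symm {c : OpenPartialHomeomorph M 𝔼} (hc : c ∈ atlas 𝔼 M) :
    ContMDiffOn 𝕀 𝕀 ∞ c.symm c.target :=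
  contMDiffOn_symm_of_mem_maximalAtlas (IsManifold.subset_maximalAtlas hc)

/-- The coordinate vector fields of a chart are smooth. -/
theorem contMDiffOn_mfderiv_symm {c : OpenPartialHomeomorph M 𝔼} (hc : c ∈ atlas 𝔼 M) (v : 𝔼) :
    ContMDiffOn 𝕀 (𝕀).tangent 2
      (fun q => (⟨c.symm q, mfderiv 𝕀 𝕀 c.symm q v⟩ : TangentBundle 𝕀 M)) c.target := by
  have h1 := (contMDiffOn_chart_symm hc).contMDiffOn_tangentMapWithin (m := 2) (by norm_cast)
    c.open_target.uniqueMDiffOn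
  have h2 : ContMDiffOn 𝕀 (𝕀).tangent 2 (fun q : 𝔼 => (⟨q, v⟩ : TangentBundle 𝕀 𝔼)) c.target :=
    contMDiffOn_vectorSpace_iff_contDiffOn.2 contDiffOn_const
  refine (h1.comp h2 fun q hq => hq).congr fun q hq => ?_
  simp only [Function.comp, tangentMapWithin, mfderivWithin_of_isOpen c.open_target hq]

theorem contDiffOn_kineticBilin (A : RiemannMetric m M) {c : OpenPartialHomeomorph M 𝔼}
    (hc : c ∈ atlas 𝔼 M) : ContDiffOn ℝ 2 (kineticBilin A c) c.target := by
  refine contDiffOn_clm_apply.2 fun v => contDiffOn_clm_apply.2 fun w => ?_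
  have h := ContMDiffOn.clm_bundle_apply₂ (F₁ := 𝔼) (F₂ := 𝔼) (F₃ := ℝ) (n := 2)
    (E₃ := Bundle.Trivial M ℝ)
    (ψ := fun q => A.inner (c.symm q)) (s := c.target)
    (((A.contMDiff.of_le (by norm_cast)).comp_contMDiffOn
      ((contMDiffOn_chart_symm hc).of_le (by norm_cast))))
    (contMDiffOn_mfderiv_symm hc v) (contMDiffOn_mfderiv_symm hc w)
  refine contMDiffOn_iff_contDiffOn.1 fun q hq => ?_
  have := h q hq
  simp only [Bundle.contMDiffWithinAt_totalSpace] at this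
  exact this.2

/-- The squared speed `⟨A(x) ẋ, ẋ⟩` of a curve. -/
def sqSpeed (A : RiemannMetric m M) (x : ℝ → M) (t : ℝ) : ℝ :=
  A.inner (x t) (mfderiv 𝓘(ℝ, ℝ) 𝕀 x t (1 : ℝ)) (mfderiv 𝓘(ℝ, ℝ) 𝕀 x t (1 : ℝ))

theorem sqSpeed_nonneg (A : RiemannMetric m M) (x : ℝ → M) (t : ℝ) : 0 ≤ sqSpeed A x t := by
  by_cases h : mfderiv 𝓘(ℝ, ℝ) 𝕀 x t (1 : ℝ) = 0
  · simp [sqSpeed, h]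
  · exact (A.pos _ _ h).le

variable {x : ℝ → M} {c : OpenPartialHomeomorph M (EuclideanSpace ℝ (Fin m))} {t : ℝ}

theorem contDiffAt_chart_comp (hx : ContMDiff 𝓘(ℝ, ℝ) 𝕀 2 x) (hc : c ∈ atlas 𝔼 M)
    (ht : x t ∈ c.source) : ContDiffAt ℝ 2 (fun s => c (x s)) t := by
  have h := contMDiffAt_of_mem_maximalAtlas (I := 𝕀) (n := ∞)
    (IsManifold.subset_maximalAtlas hc) ht
  exact contMDiffAt_iff_contDiffAt.1 ((h.of_le (by norm_cast)).comp t hx.contMDiffAt)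

theorem contDiffAt_comp_chart_symm {f : M → ℝ} (hf : ContMDiff 𝕀 𝓘(ℝ, ℝ) ∞ f)
    (hc : c ∈ atlas 𝔼 M) {q : 𝔼} (hq : q ∈ c.target) :
    ContDiffAt ℝ ∞ (fun q => f (c.symm q)) q :=
  contMDiffAt_iff_contDiffAt.1 (hf.contMDiffAt.comp q
    ((contMDiffOn_chart_symm hc).contMDiffAt (c.open_target.mem_nhds hq)))

theorem sqSpeed_eq (A : RiemannMetric m M) (hx : ContMDiff 𝓘(ℝ, ℝ) 𝕀 2 x) (hc : c ∈ atlas 𝔼 M)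
    (ht : x t ∈ c.source) : sqSpeed A x t = kineticBilin A c (c (x t))
      (deriv (fun s => c (x s)) t) (deriv (fun s => c (x s)) t) := by
  set q : ℝ → 𝔼 := fun s => c (x s) with hq
  have hqd : HasMFDerivAt 𝓘(ℝ, ℝ) 𝕀 q t (fderiv ℝ q t) :=
    (((contDiffAt_chart_comp hx hc ht).differentiableAt (by norm_num)).hasFDerivAt).hasMFDerivAt
  have hsd : MDifferentiableAt 𝕀 𝕀 c.symm (q t) :=
    ((contMDiffOn_chart_symm hc).contMDiffAt (c.open_target.mem_nhds (c.map_source ht))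
      ).mdifferentiableAt (by norm_num)
  have hcomp := hsd.hasMFDerivAt.comp t hqd
  have hev : x =ᶠ[𝓝 t] c.symm ∘ q := by
    filter_upwards [hx.continuous.continuousAt (c.open_source.mem_nhds ht)] with s hs
    exact (c.left_inv hs).symm
  have hxd := (hcomp.congr_of_eventuallyEq hev).mfderiv
  -- The fibres over `x t` and over `c.symm (q t)` are the same space, but not definitionally.
  let G : M → 𝔼 → ℝ := fun y v => A.inner y v v
  change G (x t) (mfderiv 𝓘(ℝ, ℝ) 𝕀 x t (1 : ℝ)) = G (c.symm (q t)) (mfderiv 𝕀 𝕀 c.symm (q t) _)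
  rw [hxd, hq, c.left_inv ht]
  rfl

theorem deriv_comp_eq {f : M → ℝ} (hf : ContMDiff 𝕀 𝓘(ℝ, ℝ) ∞ f) (hx : ContMDiff 𝓘(ℝ, ℝ) 𝕀 2 x)
    (hc : c ∈ atlas 𝔼 M) (ht : x t ∈ c.source) : deriv (fun s => f (x s)) t
      = fderiv ℝ (fun q => f (c.symm q)) (c (x t)) (deriv (fun s => c (x s)) t) := by
  have hev : (fun s => f (x s)) =ᶠ[𝓝 t] fun s => f (c.symm (c (x s))) := by
    filter_upwards [hx.continuous.continuousAt (c.open_source.mem_nhds ht)] with s hs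
    rw [c.left_inv hs]
  rw [hev.deriv_eq]
  have h1 := ((contDiffAt_comp_chart_symm hf hc (c.map_source ht)).differentiableAt
    (by norm_num)).hasFDerivAt
  have h2 := ((contDiffAt_chart_comp hx hc ht).differentiableAt (by norm_num)).hasDerivAt
  exact (h1.comp_hasDerivAt t h2).deriv

/-- The mechanical energy changes by the work of the force. -/
theorem hasDerivAt_mechanicalEnergy (A : RiemannMetric m M) {V₀ f : M → ℝ}
    (hV₀ : ContMDiff 𝕀 𝓘(ℝ, ℝ) ∞ V₀) (hf : ContMDiff 𝕀 𝓘(ℝ, ℝ) ∞ f)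
    (hx : ContMDiff 𝓘(ℝ, ℝ) 𝕀 2 x) {Φ : ℝ → ℝ}
    (hEL : ∀ c ∈ atlas 𝔼 M, ∀ t : ℝ, x t ∈ c.source → HasDerivAt
      (fun s : ℝ => fderiv ℝ (fun v => lagrangian A V₀ c (c (x s)) v) (deriv (fun r => c (x r)) s))
      (fderiv ℝ (fun q => lagrangian A V₀ c q (deriv (fun r => c (x r)) t)) (c (x t))
        + Φ t • fderiv ℝ (fun q => f (c.symm q)) (c (x t))) t) (t : ℝ) :
    HasDerivAt (fun s => sqSpeed A x s / 2 + V₀ (x s)) (Φ t * deriv (fun s => f (x s)) t) t := by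
  set c := chartAt 𝔼 (x t) with hcdef
  have hc : c ∈ atlas 𝔼 M := chart_mem_atlas 𝔼 (x t)
  have ht : x t ∈ c.source := mem_chart_source 𝔼 (x t)
  have hq := contDiffAt_chart_comp hx hc ht
  have h := hasDerivAt_energy_of_eulerLagrange (B := kineticBilin A c)
    (U := fun q => V₀ (c.symm q)) (F := fun q => f (c.symm q)) (q := fun s => c (x s)) (t := t)
    (Φ := Φ t) (kineticBilin_symm A c)
    (((contDiffOn_kineticBilin A hc).contDiffAt
      (c.open_target.mem_nhds (c.map_source ht))).differentiableAt (by norm_num))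
    ((contDiffAt_comp_chart_symm hV₀ hc (c.map_source ht)).differentiableAt (by norm_num))
    (hq.differentiableAt (by norm_num))
    (((hq.fderiv_right (m := 1) (by norm_num)).clm_apply contDiffAt_const).differentiableAt
      (by norm_num)) (hEL c hc t ht)
  rw [deriv_comp_eq hf hx hc ht]
  refine h.congr_of_eventuallyEq ?_
  filter_upwards [hx.continuous.continuousAt (c.open_source.mem_nhds ht)] with s hs
  rw [sqSpeed_eq A hx hc hs, c.left_inv hs]

/-- As long as a curve stays in a compact set, the rate of change of a smooth function along it is
controlled by its speed. -/
theorem exists_sq_deriv_le_sqSpeed (A : RiemannMetric m M) {f : M → ℝ}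
    (hf : ContMDiff 𝕀 𝓘(ℝ, ℝ) ∞ f) (hx : ContMDiff 𝓘(ℝ, ℝ) 𝕀 2 x) {S : Set M} (hS : IsCompact S) :
    ∃ C, 0 ≤ C ∧ ∀ t, x t ∈ S → deriv (fun s => f (x s)) t ^ 2 ≤ C * sqSpeed A x t := by
  refine hS.induction_on (p := fun S => ∃ C, 0 ≤ C ∧ ∀ t, x t ∈ S →
    deriv (fun s => f (x s)) t ^ 2 ≤ C * sqSpeed A x t) ?_ ?_ ?_ ?_
  · exact ⟨0, le_rfl, fun t ht => ht.elim⟩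
  · rintro s s' hss' ⟨C, hC0, hC⟩
    exact ⟨C, hC0, fun t ht => hC t (hss' ht)⟩
  · rintro s s' ⟨C, hC0, hC⟩ ⟨C', hC0', hC'⟩
    refine ⟨max C C', hC0.trans (le_max_left _ _), fun t ht => ?_⟩
    rcases ht with ht | ht
    · exact (hC t ht).trans
        (mul_le_mul_of_nonneg_right (le_max_left _ _) (sqSpeed_nonneg A x t))
    · exact (hC' t ht).trans
        (mul_le_mul_of_nonneg_right (le_max_right _ _) (sqSpeed_nonneg A x t))
  · intro y hy
    set c := chartAt 𝔼 y with hcdef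
    have hc : c ∈ atlas 𝔼 M := chart_mem_atlas 𝔼 y
    have hyc : y ∈ c.source := mem_chart_source 𝔼 y
    have hyt := c.map_source hyc
    have hBc : ContinuousAt (kineticBilin A c) (c y) :=
      (contDiffOn_kineticBilin A hc).continuousOn.continuousAt (c.open_target.mem_nhds hyt)
    obtain ⟨δ, hδ, hev⟩ := exists_pos_mul_sq_norm_le hBc fun v hv => kineticBilin_pos A hc hyt hv
    have hF : ContinuousAt (fun q => ‖fderiv ℝ (fun q => f (c.symm q)) q‖) (c y) :=
      ((contDiffAt_comp_chart_symm hf hc hyt).continuousAt_fderiv (by norm_num)).norm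
    set N := ‖fderiv ℝ (fun q => f (c.symm q)) (c y)‖ + 1 with hN
    have hFev := hF.eventually (gt_mem_nhds (lt_add_one _))
    have hall := (c.continuousAt hyc).eventually (hev.and hFev)
    refine ⟨_, mem_nhdsWithin_of_mem_nhds (hall.and (c.open_source.mem_nhds hyc)),
      N ^ 2 / δ, by positivity, fun t ht => ?_⟩
    obtain ⟨⟨h1, h2⟩, h3⟩ := ht
    rw [deriv_comp_eq hf hx hc h3, sqSpeed_eq A hx hc h3]
    set v := deriv (fun s => c (x s)) t
    have h4 := (fderiv ℝ (fun q => f (c.symm q)) (c (x t))).le_opNorm v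
    have h5 : |fderiv ℝ (fun q => f (c.symm q)) (c (x t)) v| ≤ N * ‖v‖ :=
      h4.trans (mul_le_mul_of_nonneg_right h2.le (norm_nonneg v))
    calc _ ≤ (N * ‖v‖) ^ 2 := sq_le_sq' (by linarith [(abs_le.1 h5).1]) (abs_le.1 h5).2
      _ = N ^ 2 / δ * (δ * ‖v‖ ^ 2) := by field_simp
      _ ≤ _ := mul_le_mul_of_nonneg_left (h1 v) (by positivity)

end Kinetic

/-! ### The coupling and the oscillators -/

section Coupling

variable {ρ κ a : ℝ → ℝ}

theorem memLp_two_coupling (hρ : ∀ ν, 0 ≤ ρ ν) (hint : Integrable fun ν => κ ν ^ 2 / ρ ν)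
    (ha : ∀ᵐ ν : ℝ, a ν = κ ν / √(ρ ν)) (hac : Continuous a) : MemLp a 2 := by
  refine (memLp_two_iff_integrable_sq hac.aestronglyMeasurable).2 (hint.congr ?_)
  filter_upwards [ha] with ν hν
  rw [hν, div_pow, Real.sq_sqrt (hρ ν)]

theorem sq_coupling_div_ae_eq (hρ : ∀ ν, 0 ≤ ρ ν) (ha : ∀ᵐ ν : ℝ, a ν = κ ν / √(ρ ν)) :
    (fun ν => κ ν ^ 2 / (ρ ν * ν ^ 2)) =ᵐ[volume] fun ν => (a ν / ν) ^ 2 := by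
  filter_upwards [ha] with ν hν
  rw [hν, div_pow, div_pow, Real.sq_sqrt (hρ ν), div_div]

theorem memLp_two_coupling_div (hρ : ∀ ν, 0 ≤ ρ ν)
    (hK : Integrable fun ν => κ ν ^ 2 / (ρ ν * ν ^ 2)) (ha : ∀ᵐ ν : ℝ, a ν = κ ν / √(ρ ν))
    (hac : Continuous a) : MemLp (fun ν => a ν / ν) 2 :=
  (memLp_two_iff_integrable_sq (hac.measurable.div measurable_id).aestronglyMeasurable).2
    (hK.congr (sq_coupling_div_ae_eq hρ ha))

theorem couplingConst_eq (hρ : ∀ ν, 0 ≤ ρ ν) (ha : ∀ᵐ ν : ℝ, a ν = κ ν / √(ρ ν)) :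
    couplingConst ρ κ = ∫ ν, (a ν / ν) ^ 2 :=
  integral_congr_ae (sq_coupling_div_ae_eq hρ ha)

/-- The initial complex amplitude `√ρ (ξ̇₀ + i ν ξ₀)` of the oscillator with frequency `ν`. -/
def initAmp (ρ ξ₀ η₀ : ℝ → ℝ) (ν : ℝ) : ℂ := √(ρ ν) * (η₀ ν + Complex.I * ν * ξ₀ ν)

theorem memLp_two_initAmp {ξ₀ η₀ : ℝ → ℝ} (hρm : AEMeasurable ρ) (hρ : ∀ ν, 0 ≤ ρ ν)
    (hξ₀ : AEMeasurable ξ₀) (hη₀ : AEMeasurable η₀)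
    (hini : Integrable fun ν => ρ ν * (η₀ ν ^ 2 + ν ^ 2 * ξ₀ ν ^ 2)) :
    MemLp (initAmp ρ ξ₀ η₀) 2 := by
  have hm : AEStronglyMeasurable (initAmp ρ ξ₀ η₀) volume := by
    unfold initAmp
    fun_prop
  refine (memLp_two_iff_integrable_sq_norm hm).2 (hini.congr (Eventually.of_forall fun ν => ?_))
  have h1 : (η₀ ν + Complex.I * ν * ξ₀ ν : ℂ) = η₀ ν + ((ν * ξ₀ ν : ℝ) : ℂ) * Complex.I := by
    push_cast
    ring
  simp only [initAmp]
  rw [norm_mul, mul_pow, Complex.norm_real, Real.norm_eq_abs, sq_abs, Real.sq_sqrt (hρ ν), h1,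
    Complex.sq_norm, Complex.normSq_add_mul_I]
  ring

/-- The contribution of an oscillator to the force, in terms of its complex amplitude. -/
theorem coupling_mul_eq_im_oscAmp {ψ : ℝ → ℝ} {ξ₀ η₀ : ℝ → ℝ} {ξ : ℝ → ℝ → ℝ}
    (hρ : ∀ ν, 0 ≤ ρ ν) (hsupp : ∀ᵐ ν : ℝ, ρ ν = 0 → κ ν = 0)
    (ha : ∀ᵐ ν : ℝ, a ν = κ ν / √(ρ ν)) (hψ : Continuous ψ)
    (hosc : ∀ᵐ ν : ℝ, ρ ν ≠ 0 → ContDiff ℝ 2 (ξ ν) ∧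
      ∀ t : ℝ, ρ ν * (deriv (deriv (ξ ν)) t + ν ^ 2 * ξ ν t) = κ ν * ψ t)
    (hini : ∀ᵐ ν : ℝ, ρ ν ≠ 0 → ξ ν 0 = ξ₀ ν ∧ deriv (ξ ν) 0 = η₀ ν) :
    ∀ᵐ ν : ℝ, ∀ t, κ ν * ξ ν t = a ν / ν * (oscAmp a ψ (initAmp ρ ξ₀ η₀) ν t).im := by
  filter_upwards [hsupp, ha, hosc, hini, ae_ne_zero] with ν hs hav ho hi hν t
  by_cases hρ0 : ρ ν = 0
  · simp [hs hρ0, hav]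
  obtain ⟨hd, heq⟩ := ho hρ0
  obtain ⟨hi0, hi1⟩ := hi hρ0
  have hr0 : √(ρ ν) ≠ 0 := (Real.sqrt_ne_zero (hρ ν)).2 hρ0
  have hr : √(ρ ν) * √(ρ ν) = ρ ν := Real.mul_self_sqrt (hρ ν)
  have hκ : κ ν = a ν * √(ρ ν) := by rw [hav, div_mul_cancel₀ _ hr0]
  -- the oscillator equation as the first order equation for `√ρ (ξ̇ + i ν ξ)`
  have hz : ∀ s, HasDerivAt
      (fun s => (√(ρ ν) : ℂ) * ((deriv (ξ ν) s : ℝ) + Complex.I * ν * (ξ ν s : ℝ)))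
      (Complex.I * ν * ((√(ρ ν) : ℂ) * ((deriv (ξ ν) s : ℝ) + Complex.I * ν * (ξ ν s : ℝ)))
        + a ν * ψ s) s := fun s => by
    have h1 : HasDerivAt (fun s => ((ξ ν s : ℝ) : ℂ)) ((deriv (ξ ν) s : ℝ) : ℂ) s :=
      ((hd.differentiable (by norm_num)) s).hasDerivAt.ofReal_comp
    have hd1 : ContDiff ℝ 1 (deriv (ξ ν)) :=
      (contDiff_succ_iff_deriv (n := 1).1 (by rw [one_add_one_eq_two]; exact hd)).2.2
    have h2 : HasDerivAt (fun s => ((deriv (ξ ν) s : ℝ) : ℂ)) ((deriv (deriv (ξ ν)) s : ℝ) : ℂ) s :=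
      ((hd1.differentiable (by norm_num)) s).hasDerivAt.ofReal_comp
    refine ((h2.add (h1.const_mul (Complex.I * ν))).const_mul (√(ρ ν) : ℂ)).congr_deriv ?_
    have h3 : √(ρ ν) * (deriv (deriv (ξ ν)) s + ν ^ 2 * ξ ν s) = a ν * ψ s := by
      have h4 := heq s
      apply mul_left_cancel₀ hr0
      linear_combination h4 + (deriv (deriv (ξ ν)) s + ν ^ 2 * ξ ν s) * hr + ψ s * hκ
    have h5 : (√(ρ ν) : ℂ) * ((deriv (deriv (ξ ν)) s : ℝ) + ν ^ 2 * (ξ ν s : ℝ))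
        = a ν * ψ s := by exact_mod_cast h3
    linear_combination h5 - (√(ρ ν) : ℂ) * ν ^ 2 * (ξ ν s : ℝ) * Complex.I_sq
  have h := eq_oscAmp hψ (Z₀ := initAmp ρ ξ₀ η₀) hz (by simp [initAmp, hi0, hi1]) t
  rw [← h, hκ]
  simp
  field_simp

end Coupling

/-! ### Conservation of energy and a priori bounds -/

section Bounds

variable {m : ℕ} {M : Type*} [TopologicalSpace M] [ChartedSpace (EuclideanSpace ℝ (Fin m)) M]
  [IsManifold 𝓘(ℝ, EuclideanSpace ℝ (Fin m)) ∞ M]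

/-- The total energy is the sum of three terms that are bounded below: the kinetic energy, the
effective potential, and the energy of the oscillators relative to their moving equilibria. Its
conservation bounds each of them. -/
theorem exists_bounds (A : RiemannMetric m M) {V₀ f : M → ℝ} {ρ κ : ℝ → ℝ}
    (hV₀ : ContMDiff 𝓘(ℝ, EuclideanSpace ℝ (Fin m)) 𝓘(ℝ, ℝ) ∞ V₀)
    (hf : ContMDiff 𝓘(ℝ, EuclideanSpace ℝ (Fin m)) 𝓘(ℝ, ℝ) ∞ f)
    (hρ : ∀ ν, 0 ≤ ρ ν) (hVbdd : BddBelow (Set.range (effPotential V₀ f ρ κ)))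
    (hVcpt : ∀ e : ℝ, IsCompact {x : M | effPotential V₀ f ρ κ x ≤ e})
    {a : ℝ → ℝ} (ha : ∀ᵐ ν : ℝ, a ν = κ ν / √(ρ ν)) (hac : Continuous a)
    (hb : MemLp (fun ν => a ν / ν) 2) {Z₀ : ℝ → ℂ} (hZ : MemLp Z₀ 2) {x : ℝ → M}
    (hx : ContMDiff 𝓘(ℝ, ℝ) 𝓘(ℝ, EuclideanSpace ℝ (Fin m)) 2 x)
    (hψ : ContDiff ℝ 1 fun t => f (x t))
    (hEL : ∀ c ∈ atlas (EuclideanSpace ℝ (Fin m)) M, ∀ t : ℝ, x t ∈ c.source → HasDerivAt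
      (fun s : ℝ => fderiv ℝ (fun v => lagrangian A V₀ c (c (x s)) v) (deriv (fun r => c (x r)) s))
      (fderiv ℝ (fun q => lagrangian A V₀ c q (deriv (fun r => c (x r)) t)) (c (x t))
        + (∫ ν, a ν / ν * (oscAmp a (fun t => f (x t)) Z₀ ν t).im)
          • fderiv ℝ (fun q => f (c.symm q)) (c (x t))) t) :
    ∃ Cψ CJ L : ℝ, (∀ t, |f (x t)| ≤ Cψ) ∧ (∀ t, |deriv (fun t => f (x t)) t| ≤ L) ∧
      ∀ t, ∫ ν, ‖oscShift a (fun t => f (x t)) Z₀ ν t‖ ^ 2 / 2 ≤ CJ := by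
  set ψ : ℝ → ℝ := fun t => f (x t) with hψdef
  set J : ℝ → ℝ := fun t => ∫ ν, ‖oscShift a ψ Z₀ ν t‖ ^ 2 / 2 with hJ
  set H : ℝ → ℝ := fun t => sqSpeed A x t / 2 + effPotential V₀ f ρ κ (x t) + J t with hH
  have hKeq := couplingConst_eq hρ ha
  have hderiv : ∀ t, HasDerivAt H 0 t := fun t => by
    have h1 := hasDerivAt_mechanicalEnergy A hV₀ hf hx
      (Φ := fun t => ∫ ν, a ν / ν * (oscAmp a ψ Z₀ ν t).im) hEL t
    have h2 : HasDerivAt ψ (deriv ψ t) t := ((hψ.differentiable (by norm_num)) t).hasDerivAt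
    have h3 := ((h2.pow 2).const_mul (couplingConst ρ κ)).div_const 2
    have h4 := hasDerivAt_oscEnergy hψ hac hb hZ t
    refine (((h1.sub h3).add h4).congr_deriv ?_).congr_of_eventuallyEq
      (Eventually.of_forall fun s => ?_)
    · rw [← hKeq]
      simp
      ring
    · simp only [hH, effPotential, Pi.add_apply, Pi.sub_apply, hψdef, Pi.pow_apply]
      ring
  have hconst : ∀ t, H t = H 0 := fun t =>
    is_const_of_deriv_eq_zero (fun t => (hderiv t).differentiableAt) (fun t => (hderiv t).deriv) t 0
  have hJ0 : ∀ t, 0 ≤ J t := fun t => integral_nonneg fun ν => by positivity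
  have hT0 := sqSpeed_nonneg A x
  obtain ⟨vmin, hvmin⟩ := hVbdd
  have hv : ∀ t, vmin ≤ effPotential V₀ f ρ κ (x t) := fun t => hvmin ⟨_, rfl⟩
  have hmem : ∀ t, x t ∈ {x : M | effPotential V₀ f ρ κ x ≤ H 0} := fun t => by
    have := hconst t
    simp only [hH] at this ⊢
    simp only [Set.mem_ofPred_eq]
    linarith [hJ0 t, hT0 t]
  obtain ⟨Cψ, hCψ⟩ := (hVcpt (H 0)).exists_bound_of_continuousOn hf.continuous.continuousOn
  obtain ⟨C, hC0, hC⟩ := exists_sq_deriv_le_sqSpeed A hf hx (hVcpt (H 0))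
  refine ⟨Cψ, H 0 - vmin, √(C * (2 * (H 0 - vmin))), fun t => hCψ _ (hmem t), fun t => ?_,
    fun t => ?_⟩
  · refine Real.le_sqrt_of_sq_le ?_
    rw [sq_abs]
    refine (hC t (hmem t)).trans (mul_le_mul_of_nonneg_left ?_ hC0)
    have := hconst t
    simp only [hH] at this ⊢
    linarith [hJ0 t, hv t]
  · have := hconst t
    simp only [hH] at this ⊢
    linarith [hT0 t, hv t]

end Bounds

/-! ### The spaces `C_b` and `C_0` -/

section Spaces

theorem add_mem_Cb {u v : ℝ → ℂ} (hu : u ∈ Cb) (hv : v ∈ Cb) : (fun t => u t + v t) ∈ Cb := by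
  obtain ⟨hu, C, hC⟩ := hu
  obtain ⟨hv, D, hD⟩ := hv
  exact ⟨hu.add hv, C + D, fun t => norm_add_le_of_le (hC t) (hD t)⟩

theorem sub_mem_Cb {u v : ℝ → ℂ} (hu : u ∈ Cb) (hv : v ∈ Cb) : (fun t => u t - v t) ∈ Cb := by
  obtain ⟨hu, C, hC⟩ := hu
  obtain ⟨hv, D, hD⟩ := hv
  exact ⟨hu.sub hv, C + D, fun t => norm_sub_le_of_le (hC t) (hD t)⟩

theorem tendsto_im_fourierFun_neg (u : ℝ → ℂ) :
    Tendsto (fun t : ℝ => (((fourierFun u (-t)).im : ℝ) : ℂ)) (cocompact ℝ) (𝓝 0) := by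
  have h := (tendsto_fourierFun (u := u)).comp (Homeomorph.neg ℝ).isClosedEmbedding.tendsto_cocompact
  have h2 := (Complex.continuous_ofReal.comp Complex.continuous_im).tendsto (0 : ℂ)
  simpa [Function.comp_def] using h2.comp h

theorem im_fourierFun_neg_mem_Cb {u : ℝ → ℂ} (hu : Integrable u) :
    (fun t : ℝ => (((fourierFun u (-t)).im : ℝ) : ℂ)) ∈ Cb := by
  have hc : Continuous fun t : ℝ => (((fourierFun u (-t)).im : ℝ) : ℂ) :=
    Complex.continuous_ofReal.comp (Complex.continuous_im.comp
      ((continuous_fourierFun hu).comp continuous_neg))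
  refine ⟨hc.uniformContinuous_of_tendsto_cocompact (tendsto_im_fourierFun_neg u), ∫ τ, ‖u τ‖,
    fun t => ?_⟩
  rw [Complex.norm_real]
  exact (Complex.abs_im_le_norm _).trans (norm_fourierFun_le u (-t))

theorem mem_Cb_of_abs_deriv_le {ψ : ℝ → ℝ} (hψ : Differentiable ℝ ψ) {C L : ℝ}
    (hC : ∀ t, |ψ t| ≤ C) (hL : ∀ t, |deriv ψ t| ≤ L) :
    (fun t => (ψ t : ℂ)) ∈ Cb ∧ ∀ s t, ‖(ψ s : ℂ) - ψ t‖ ≤ L * |s - t| := by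
  have hlip : ∀ s t, ‖(ψ s : ℂ) - ψ t‖ ≤ L * |s - t| := fun s t => by
    rw [← Complex.ofReal_sub, Complex.norm_real]
    exact convex_univ.norm_image_sub_le_of_norm_deriv_le (fun x _ => hψ x) (fun x _ => hL x)
      (Set.mem_univ _) (Set.mem_univ _)
  refine ⟨⟨?_, C, fun t => by rw [Complex.norm_real]; exact hC t⟩, hlip⟩
  have h : LipschitzWith L.toNNReal fun t => (ψ t : ℂ) := LipschitzWith.of_dist_le_mul fun s t => by
    rw [dist_eq_norm, Real.dist_eq]
    exact (hlip s t).trans (mul_le_mul_of_nonneg_right (Real.le_coe_toNNReal L) (abs_nonneg _))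
  exact h.uniformContinuous

/-- If `φ` and the convolution `u * ψ` have the same asymptotics along `l`, then `φ̂ = û ψ̂` up to
the Fourier transform of a function from `C_0`. -/
theorem exists_isProd_add {l : Filter ℝ} {u φ ψ : ℝ → ℂ} (hu : Integrable u) (hφ : φ ∈ Cb)
    (hψ : ψ ∈ Cb) (hl : Tendsto (fun t => φ t - conv (densityMeasure u) ψ t) l (𝓝 0)) :
    ∃ S, IsProd (fourierFun u) (hat ψ) S ∧ ∃ θ ∈ C0Hat l, hat φ = S + θ := by
  have hconv := conv_mem_Cb (densityMeasure u) hψ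
  have hθ := sub_mem_Cb hφ hconv
  refine ⟨hat (conv (densityMeasure u) ψ),
    ⟨densityMeasure u, ψ, hψ, (measureHat_densityMeasure hu).symm, rfl, rfl⟩,
    hat fun t => φ t - conv (densityMeasure u) ψ t, ⟨_, ⟨hθ, hl⟩, rfl⟩, ?_⟩
  ext h
  have hint : ∀ {χ : ℝ → ℂ}, χ ∈ Cb → Integrable fun t => χ t * fourierFun h t := fun {χ} hχ => by
    obtain ⟨huc, C, hC⟩ := hχ
    exact (integrable_fourierFun_schwartz h).bdd_mul huc.continuous.aestronglyMeasurable
      (Eventually.of_forall hC)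
  change hat φ h = hat (conv (densityMeasure u) ψ) h + hat _ h
  rw [hat_apply (memLp_top_of_mem_Cb hφ), hat_apply (memLp_top_of_mem_Cb hconv),
    hat_apply (memLp_top_of_mem_Cb hθ), ← integral_add (hint hconv) (hint hθ)]
  exact integral_congr_ae (Eventually.of_forall fun t => by ring)

end Spaces

end OscillatorThermostat

end

open OscillatorThermostat in
theorem theorem2 {m : ℕ} {M : Type*} [TopologicalSpace M] [T2Space M] [SecondCountableTopology M]
    [ChartedSpace (EuclideanSpace ℝ (Fin m)) M]
    [IsManifold 𝓘(ℝ, EuclideanSpace ℝ (Fin m)) ∞ M]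
    -- the data: kinetic energy, potential, coupling function, density, coupling coefficient
    (A : RiemannMetric m M) (V₀ f : M → ℝ) (ρ κ : ℝ → ℝ)
    (hV₀ : ContMDiff 𝓘(ℝ, EuclideanSpace ℝ (Fin m)) 𝓘(ℝ, ℝ) ∞ V₀)
    (hf : ContMDiff 𝓘(ℝ, EuclideanSpace ℝ (Fin m)) 𝓘(ℝ, ℝ) ∞ f)
    (hρm : AEMeasurable ρ) (hκm : AEMeasurable κ)
    (hρ : ∀ ν, 0 ≤ ρ ν) (hsupp : ∀ᵐ ν : ℝ, ρ ν = 0 → κ ν = 0)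
    -- the two finite integrals
    (hint : Integrable (fun ν : ℝ => κ ν ^ 2 / ρ ν))
    (hK : Integrable (fun ν : ℝ => κ ν ^ 2 / (ρ ν * ν ^ 2)))
    -- the effective potential
    (hVbdd : BddBelow (Set.range (effPotential V₀ f ρ κ)))
    (hVf : (∃ C : ℝ, ∀ x, |f x| ≤ C) ∨
      Tendsto (effPotential V₀ f ρ κ) (comap (fun x => |f x|) atTop) atTop)
    (hVcpt : ∀ e : ℝ, IsCompact {x : M | effPotential V₀ f ρ κ x ≤ e})
    -- the initial data
    (z₀ : TangentBundle 𝓘(ℝ, EuclideanSpace ℝ (Fin m)) M) (ξ₀ η₀ : ℝ → ℝ)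
    (hξ₀ : AEMeasurable ξ₀) (hη₀ : AEMeasurable η₀)
    (hini : Integrable (fun ν : ℝ => ρ ν * (η₀ ν ^ 2 + ν ^ 2 * ξ₀ ν ^ 2)))
    -- `a` is the continuous representative of `κ / √ρ`
    (a : ℝ → ℝ) (ha : ∀ᵐ ν : ℝ, a ν = κ ν / √(ρ ν))
    (haM : (fun ν => (a ν : ℂ)) ∈ MHat)
    (hadiff : Differentiable ℝ a) (ha'M : (fun ν => ((deriv a ν : ℝ) : ℂ)) ∈ MHat)
    (ha0 : a 0 = 0)
    -- the solution
    (x : ℝ → M) (ξ : ℝ → ℝ → ℝ) (hsol : IsSolution A V₀ f ρ κ z₀ ξ₀ η₀ x ξ)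
    (ψ φ : ℝ → ℂ) (hψ : ∀ t, ψ t = (f (x t) : ℂ))
    (hφ : ∀ t, φ t = ((∫ ν, κ ν * ξ ν t : ℝ) : ℂ)) :
    -- the objects of the conclusion are well defined
    ((∀ t, Integrable (fun ν => κ ν * ξ ν t)) ∧ Integrable (wHat a) ∧ Integrable (wKer a)) ∧
    -- `ψ` and `φ` are bounded (and uniformly continuous)
    (ψ ∈ Cb ∧ φ ∈ Cb) ∧
    -- the first assertion
    ((∃ S, IsProd (fun ν => (a ν : ℂ)) (hat ψ) S ∧ IsLp 2 S) ∧
      (∃ S, IsProd (wHat a) (hat ψ) S ∧ IsLp 1 S) ∧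
      singSupp (hat ψ) ∩ {ν | a ν ≠ 0} = ∅) ∧
    -- the second assertion
    ((∃ S, IsProd (fourierFun (wDiamondPlus a)) (hat ψ) S ∧
        ∃ θ ∈ C0Hat atTop, hat φ = S + θ) ∧
      (∃ S, IsProd (fourierFun (wDiamondMinus a)) (hat ψ) S ∧
        ∃ θ ∈ C0Hat atBot, hat φ = S + θ)) := by
  have hac : Continuous a := hadiff.continuous
  obtain ⟨μ, hμ⟩ := haM
  have hμa : ∀ ν, measureHat μ ν = a ν := fun ν => congrFun hμ ν
  obtain ⟨μ', hμ'⟩ := ha'M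
  have ha1 : ContDiff ℝ 1 a := by
    refine contDiff_one_iff_deriv.2 ⟨hadiff, ?_⟩
    have h := Complex.continuous_re.comp (continuous_measureHat μ')
    rw [hμ'] at h
    simpa [Function.comp_def] using h
  obtain ⟨Ca, hCa⟩ : ∃ C, ∀ ν, |deriv a ν| ≤ C := by
    obtain ⟨C, hC⟩ := exists_norm_measureHat_le μ'
    refine ⟨C, fun ν => ?_⟩
    have h := hC ν
    rwa [hμ', Complex.norm_real] at h
  have ha2 : MemLp a 2 := memLp_two_coupling hρ hint ha hac
  have hb : MemLp (fun ν => a ν / ν) 2 := memLp_two_coupling_div hρ hK ha hac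
  have hZ : MemLp (initAmp ρ ξ₀ η₀) 2 := memLp_two_initAmp hρm hρ hξ₀ hη₀ hini
  set Z₀ := initAmp ρ ξ₀ η₀
  -- the force in terms of the oscillator amplitudes
  have hx := hsol.contMDiff
  have hψ1 : ContDiff ℝ 1 fun t => f (x t) :=
    contMDiff_iff_contDiff.1 ((hf.of_le (by norm_cast)).comp (hx.of_le (by norm_num)))
  have hκξ := coupling_mul_eq_im_oscAmp hρ hsupp ha hψ1.continuous hsol.oscillators hsol.initial_ξ
  have hκξt : ∀ t, (fun ν => κ ν * ξ ν t)
      =ᵐ[volume] fun ν => a ν / ν * (oscAmp a (fun t => f (x t)) Z₀ ν t).im := fun t => by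
    filter_upwards [hκξ] with ν hν using hν t
  have hΦ := fun t => integral_congr_ae (hκξt t)
  have hELa := hsol.eulerLagrange
  simp only [hΦ] at hELa
  obtain ⟨Cψ, CJ, L, hCψ, hL, hCJ⟩ :=
    exists_bounds A hV₀ hf hρ hVbdd hVcpt ha hac hb hZ hx hψ1 hELa
  obtain ⟨hψCb, hψL⟩ := mem_Cb_of_abs_deriv_le (hψ1.differentiable (by norm_num)) hCψ hL
  obtain rfl : ψ = fun t => (f (x t) : ℂ) := funext hψ
  -- the kernels
  have hw := inWiener_wHat hadiff ha0 ha2 hb hCa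
  have hwKer : Integrable (wKer a) := integrable_fourierInvFun hw.integrable_fourierFun
  have hwHat : measureHat (densityMeasure (wKer a)) = wHat a :=
    (measureHat_densityMeasure hwKer).trans
      (fourierFun_fourierInvFun hw.continuous hw.integrable hw.integrable_fourierFun)
  set k : ℝ → ℂ := fun τ => (((response a τ).im : ℝ) : ℂ) with hk
  have hkint : Integrable k := by
    simp only [hk, ← wKer_sub_wKer_neg]
    exact (hwKer.sub hwKer.comp_neg).div_const 2
  have hkB : ∀ τ, ‖k τ‖ ≤ ∫ ν, ‖((a ν ^ 2 / ν : ℝ) : ℂ)‖ := fun τ => by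
    rw [hk, Complex.norm_real]
    exact (Complex.abs_im_le_norm _).trans (norm_response_le a τ)
  have hplus : wDiamondPlus a = (Set.Ioi 0).indicator k := by
    ext τ
    simp only [wDiamondPlus, Set.indicator_apply, Set.mem_Ioi, hk, wKer_sub_wKer_neg]
  have hminus : wDiamondMinus a = (Set.Iio 0).indicator fun τ => -k τ := by
    ext τ
    simp only [wDiamondMinus, Set.indicator_apply, Set.mem_Iio, hk, wKer_sub_wKer_neg]
  -- the decomposition of the force
  set θ₀ : ℝ → ℂ := fun t =>
    (((fourierFun (fun ν => ((a ν / ν : ℝ) : ℂ) * Z₀ ν) (-t)).im : ℝ) : ℂ) with hθ₀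
  have hθ₀Cb : θ₀ ∈ Cb := im_fourierFun_neg_mem_Cb
    ((hb.ofReal : MemLp (fun ν => ((a ν / ν : ℝ) : ℂ)) 2).integrable_mul hZ)
  have hθ₀lim : Tendsto θ₀ (cocompact ℝ) (𝓝 0) := tendsto_im_fourierFun_neg _
  obtain rfl : φ = fun t => θ₀ t + retarded k (fun t => (f (x t) : ℂ)) t := funext fun t => by
    rw [hφ, hΦ, integral_mul_im_oscAmp hψ1 ha2 hb hZ]
  have hφCb := add_mem_Cb hθ₀Cb (retarded_mem_Cb hkint hkB hψCb hψL)
  -- the products of `ψ̂` with `a` and `ŵ`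
  obtain ⟨C, hC⟩ := exists_eLpNorm_window_le hψ1 hac hb hZ hCψ hCJ
  obtain ⟨g, hg, hga, hgw⟩ := exists_memLp_two_hat_conv μ hψCb C (by simpa only [hμa] using hC)
  have hc : MemLp (fun ν => 2 * Real.pi / Complex.I * ((a ν / ν : ℝ) : ℂ)) 2 :=
    (hb.ofReal : MemLp (fun ν => ((a ν / ν : ℝ) : ℂ)) 2).const_mul _
  have hgw' := hgw (densityMeasure (wKer a)) _ hc fun ν => by
    rw [hwHat, hμa, wHat_eq]
    push_cast
    ring
  have hχCb := conv_mem_Cb μ hψCb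
  have hχ0 := tendsto_zero_of_memLp_two hχCb.1
    (memLp_two_of_hat (memLp_top_of_mem_Cb hχCb) hg hga)
  refine ⟨⟨fun t => ?_, integrable_wHat ha2 hb, hwKer⟩, ⟨hψCb, hφCb⟩, ⟨?_, ?_, ?_⟩, ?_, ?_⟩
  · exact (integrable_mul_im_oscAmp hψ1 hac hb hZ t).congr (hκξt t).symm
  · exact ⟨_, ⟨μ, _, hψCb, hμ.symm, rfl, rfl⟩, isLp_of_forall_apply hg hga⟩
  · exact ⟨_, ⟨_, _, hψCb, hwHat.symm, rfl, rfl⟩,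
      isLp_of_forall_apply (memLp_one_iff_integrable.2 (hg.integrable_mul hc)) hgw'⟩
  · refine Set.eq_empty_of_forall_notMem fun s ⟨hs, has⟩ => ?_
    rcases hs with hs | hs
    · exact notMem_singSuppAlong (fun τ => tendsto_atTop_add_const_right _ (-τ) tendsto_id) ha1 μ
        hμa hψCb ⟨hχCb, hχ0.mono_left atTop_le_cocompact⟩ has hs
    · exact notMem_singSuppAlong (fun τ => tendsto_atBot_add_const_right _ (-τ) tendsto_id) ha1 μ
        hμa hψCb ⟨hχCb, hχ0.mono_left atBot_le_cocompact⟩ has hs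
  · rw [hplus]
    refine exists_isProd_add (hkint.indicator measurableSet_Ioi) hφCb hψCb ?_
    have h := (hθ₀lim.mono_left atTop_le_cocompact).add
      (tendsto_retarded_sub_conv_atTop hkint hψCb)
    simpa only [add_zero, add_sub_assoc] using h
  · rw [hminus]
    refine exists_isProd_add (hkint.neg.indicator measurableSet_Iio) hφCb hψCb ?_
    have h := (hθ₀lim.mono_left atBot_le_cocompact).add
      (tendsto_retarded_sub_conv_atBot hkint hψCb)
    simpa only [add_zero, add_sub_assoc] using h
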